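/- **Proposition (Sandwiching optimally tuned NMSE).** For a nonempty set $A\subseteq\mathbb{R}^n$ let $\mathbf{D}(A)=\mathbb{E}[\mathrm{dist}(\mathbf{g},A)^2]$, where $\mathbf{g}\sim\mathcal{N}(0,\mathbf{I}_n)$ and $\mathrm{dist}(\mathbf g,A)=\inf_{\mathbf u\in A}\|\mathbf g-\mathbf u\|_2$. Let $\mathrm{cone}(A)=\{\lambda \mathbf{x}:\mathbf{x}\in A,\ \lambda\ge 0\}$ and $\lambda A=\{\lambda\mathbf x:\mathbf x\in A\}$. For a convex function $f:\mathbb{R}^n\to\mathbb{R}$ let $\partial f(\mathbf{x}_0)$ denote its subdifferential at $\mathbf{x}_0\in\mathbb{R}^n$. 1. Let $k\ge 1$, let $\mathbf{x}_0\in\mathbb{R}^n$ have exactly $k$ nonzero entries, and let $f=\|\cdot\|_1$. Then the minimum below is attained and $$1\le \frac{\min_{\lambda\ge 0}\mathbf{D}(\lambda\,\partial f(\mathbf{x}_0))}{\mathbf{D}(\mathrm{cone}(\partial f(\mathbf{x}_0)))}\le 1+2\sqrt{\frac{n}{k^3}}.$$ 2. Let $r\ge 1$, let $n=d^2$, let $\mathbf{x}_0\in\mathbb{R}^{n}$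 be the vectorization of a $d\times d$ real matrix of rank $r$, and let $f=\|\cdot\|_\star$ be the nuclear norm (the sum of the singular values of the matrix). Then the minimum below is attained and $$1\le \frac{\min_{\lambda\ge 0}\mathbf{D}(\lambda\,\partial f(\mathbf{x}_0))}{\mathbf{D}(\mathrm{cone}(\partial f(\mathbf{x}_0)))}\le 1+2\sqrt{\frac{1}{r^3 d}}.$$ 3. Let $n=tb$ and let the $n$ coordinates be partitioned into $t$ known blocks of size $b$. Let $k\ge 1$, let $\mathbf{x}_0\in\mathbb{R}^n$ have exactly $k$ nonzero blocks, and let $f(\mathbf{x})=\|\mathbf{x}\|_{1,2}=\sum_{i=1}^t\|\mathbf{x}_i\|_2$, where $\mathbf{x}_i$ is the subvector of $\mathbf{x}$ on the $i$-th block. Then the minimum below is attained and $$1\le \frac{\min_{\lambda\ge 0}\mathbf{D}(\lambda\,\partial f(\mathbf{x}_0))}{\mathbf{D}(\mathrm{cone}(\partial f(\mathbf{x}_0)))}\le 1+2\sqrt{\frac{t}{b^2k^3}}.$$ -/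

import Mathlib

open MeasureTheory ProbabilityTheory
open scoped Pointwise

/-- The subdifferential `∂f(x)`: the set of all subgradients of `f` at `x`. -/
def subdifferential {ι : Type*} [Fintype ι] (f : EuclideanSpace ℝ ι → ℝ)
    (x : EuclideanSpace ℝ ι) : Set (EuclideanSpace ℝ ι) :=
  {s | ∀ y, f x + inner ℝ s (y - x) ≤ f y}

/-- `cone(A) = {c x : x ∈ A, c ≥ 0}`. -/
def coneOf {ι : Type*} [Fintype ι] (A : Set (EuclideanSpace ℝ ι)) :
    Set (EuclideanSpace ℝ ι) :=
  {z | ∃ c : ℝ, 0 ≤ c ∧ ∃ x ∈ A, z = c • x}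

/-- The mean-squared-distance `D(A) = E[dist(g, A)²]`, where `g` is a standard Gaussian vector. -/
noncomputable def msd {ι : Type*} [Fintype ι] (A : Set (EuclideanSpace ℝ ι)) : ℝ :=
  ∫ g, Metric.infDist g A ^ 2 ∂(stdGaussian (EuclideanSpace ℝ ι))

/-- The integrand in the definition of `msd` is integrable. -/
theorem integrable_infDist_sq {ι : Type*} [Fintype ι] (A : Set (EuclideanSpace ℝ ι)) :
    Integrable (fun g => Metric.infDist g A ^ 2) (stdGaussian (EuclideanSpace ℝ ι)) := by
  have hid : MemLp id 2 (stdGaussian (EuclideanSpace ℝ ι)) := IsGaussian.memLp_two_id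
  have hn : MemLp (fun g : EuclideanSpace ℝ ι => ‖g‖ + Metric.infDist 0 A) 2
      (stdGaussian (EuclideanSpace ℝ ι)) := hid.norm.add (memLp_const _)
  refine (hn.mono (Metric.continuous_infDist_pt A).aestronglyMeasurable
    (Filter.Eventually.of_forall fun g => ?_)).integrable_sq
  have h := Metric.infDist_le_infDist_add_dist (s := A) (x := g) (y := 0)
  rw [dist_zero_right] at h
  have h0 : 0 ≤ Metric.infDist g A := Metric.infDist_nonneg
  have h1 : 0 ≤ Metric.infDist (0 : EuclideanSpace ℝ ι) A := Metric.infDist_nonneg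
  rw [Real.norm_of_nonneg h0, Real.norm_of_nonneg (by positivity)]
  linarith

/-- The `ℓ₁` norm. -/
noncomputable def l1Norm {n : ℕ} (x : EuclideanSpace ℝ (Fin n)) : ℝ :=
  ∑ i, |x i|

/-- The `d × d` matrix whose vectorization is `x`. -/
def unvec {d : ℕ} (x : EuclideanSpace ℝ (Fin d × Fin d)) : Matrix (Fin d) (Fin d) ℝ :=
  Matrix.of fun i j => x (i, j)

/-- The nuclear norm (sum of the singular values) of the matrix whose vectorization is `x`. -/
noncomputable def nuclearNorm {d : ℕ} (x : EuclideanSpace ℝ (Fin d × Fin d)) : ℝ :=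
  ∑ i ∈ Finset.range d, (Matrix.toEuclideanLin (unvec x)).singularValues i

/-- The `ℓ₁,₂` norm (sum of the Euclidean norms of the blocks), where `blk j` is the index of the
block that contains coordinate `j`. -/
noncomputable def l12Norm {n t : ℕ} (blk : Fin n → Fin t) (x : EuclideanSpace ℝ (Fin n)) : ℝ :=
  ∑ i : Fin t, Real.sqrt (∑ j with blk j = i, x j ^ 2)

/-!
All three estimates follow from one statement about a nonempty closed convex set `S`, here the
subdifferential, all of whose points have norm at most `σ` and the same coordinates `c` in some
orthonormal family `w` of `N` vectors, where `∑ a, c a ^ 2 = ρ ^ 2` with `ρ ≥ 1`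
(`sandwich_of_orthonormal`): the ratio is at most `1 + 2 σ / (ρ N)`. It combines two bounds.

*The gap.* Let `τ g` be the scale of the projection of a Gaussian vector `g` onto the cone of `S`, and
let `t` be its mean. Convexity bounds the difference of the squared distances of `g` to `t • S` and to
the cone by `2 (τ g - t) h(g)` with `h` a `σ`-Lipschitz function, while `τ` is `1 / ρ`-Lipschitz. The
Gaussian covariance inequality (`integral_mul_sub_integral_mul_integral_le`) then bounds the gap between
`msd (t • S)` and `msd (coneOf S)` by `2 σ / ρ` (`exists_msd_smul_le_msd_coneOf_add`). That inequality is
proved by rotating one of two independent Gaussian vectors into the other, using Rademacher's theorem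
for the differentiability and a reflection in place of integration by parts.

*The cone.* On the span of `w` the cone is a ray, so its mean squared distance is at least `N - 1 / 2`.
An extra direction on which `S` is bounded by `1` raises this to `N` (`card_le_msd_coneOf`), which is what
the stated constants need. Such a direction exists unless `w` spans the space, and then dilation by `0`
already gives the bound.

For the `ℓ₁,₂` norm, `w` consists of the coordinates in the nonzero blocks, so `N = b k`, `ρ = √k` and
`σ = √t`; the `ℓ₁` norm is the case of blocks of size one. For the nuclear norm, every subgradient maps
the right singular vectors `v_i` with positive singular value to the left ones, so `w` consists of the
rank-one matrices `e_a v_iᵀ`, with `N = d r`, `ρ = √r` and `σ = √d`.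
-/

/-! ### Covariances of Lipschitz functions of a Gaussian vector -/

section Gaussian

open scoped NNReal RealInnerProductSpace

/-- Peeling off one coordinate at a time reduces absolute continuity of the product Gaussian to the
one-dimensional case. -/
theorem pi_gaussianReal_absolutelyContinuous (n : ℕ) :
    (Measure.pi fun _ : Fin n => gaussianReal 0 1) ≪ (volume : Measure (Fin n → ℝ)) := by
  induction n with
  | zero =>
    rw [volume_pi, Measure.pi_of_empty, Measure.pi_of_empty]
  | succ n ih =>
    have h1 := measurePreserving_piFinSuccAbove
      (fun _ : Fin (n + 1) => gaussianReal 0 1) 0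
    have h2 := volume_preserving_piFinSuccAbove (fun _ : Fin (n + 1) => ℝ) 0
    have h3 : ((gaussianReal 0 1).prod (Measure.pi fun _ : Fin n => gaussianReal 0 1)) ≪
        (volume : Measure (ℝ × (Fin n → ℝ))) :=
      (gaussianReal_absolutelyContinuous 0 one_ne_zero).prod ih
    have h4 := h3.map (MeasurableEquiv.piFinSuccAbove (fun _ : Fin (n + 1) => ℝ) 0).symm.measurable
    rwa [← h1.map_eq, ← h2.map_eq, Measure.map_map (by fun_prop) (by fun_prop),
      Measure.map_map (by fun_prop) (by fun_prop), MeasurableEquiv.symm_comp_self,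
      Measure.map_id, Measure.map_id] at h4

variable {E : Type*} [NormedAddCommGroup E] [InnerProductSpace ℝ E] [FiniteDimensional ℝ E]
  [MeasurableSpace E] [BorelSpace E]

/-- Absolute continuity lets Rademacher's theorem be applied almost surely at a Gaussian point. -/
theorem stdGaussian_absolutelyContinuous : stdGaussian E ≪ (volume : Measure E) := by
  have h := (stdOrthonormalBasis ℝ E).measurePreserving_repr_symm.comp
    (PiLp.volume_preserving_toLp (Fin (Module.finrank ℝ E)))
  have h2 := (pi_gaussianReal_absolutelyContinuous (Module.finrank ℝ E)).map h.measurable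
  rw [h.map_eq] at h2
  have h3 : (fun x : Fin (Module.finrank ℝ E) → ℝ => ∑ i, x i • stdOrthonormalBasis ℝ E i) =
      (stdOrthonormalBasis ℝ E).repr.symm ∘ WithLp.toLp 2 := by
    ext x
    simp [OrthonormalBasis.sum_repr_symm]
  rw [stdGaussian, h3]
  exact h2

theorem memLp_lipschitz_stdGaussian {C : ℝ≥0} {f : E → ℝ} (hf : LipschitzWith C f) :
    MemLp f 2 (stdGaussian E) := by
  have hid : MemLp id 2 (stdGaussian E) := IsGaussian.memLp_two_id
  have hn : MemLp (fun g : E => C * ‖g‖ + ‖f 0‖) 2 (stdGaussian E) :=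
    (hid.norm.const_mul _).add (memLp_const _)
  refine hn.mono hf.continuous.aestronglyMeasurable (Filter.Eventually.of_forall fun g => ?_)
  have h1 := hf.norm_sub_le g 0
  rw [sub_zero] at h1
  have h2 := norm_sub_norm_le (f g) (f 0)
  have h3 : 0 ≤ C * ‖g‖ + ‖f 0‖ := by positivity
  rw [Real.norm_of_nonneg h3]
  linarith

theorem integrable_inner_sq_stdGaussian (v : E) :
    Integrable (fun g => ⟪v, g⟫ ^ 2) (stdGaussian E) :=
  (IsGaussian.memLp_dual (stdGaussian E) (innerSL ℝ v) 2 (by simp)).integrable_sq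

theorem integral_inner_sq_stdGaussian (v : E) :
    ∫ g, ⟪v, g⟫ ^ 2 ∂(stdGaussian E) = ‖v‖ ^ 2 := by
  have h := variance_dual_stdGaussian (innerSL ℝ v : StrongDual ℝ E)
  rw [variance_of_integral_eq_zero (by fun_prop) (integral_strongDual_stdGaussian _),
    innerSL_apply_norm] at h
  simpa using h

theorem integral_comp_linearIsometryEquiv_stdGaussian (R : E ≃ₗᵢ[ℝ] E) (f : E → ℝ) :
    ∫ g, f (R g) ∂(stdGaussian E) = ∫ g, f g ∂(stdGaussian E) := by
  conv_rhs => rw [← stdGaussian_map R]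
  exact (integral_map_equiv R.toHomeomorph.toMeasurableEquiv f).symm

theorem integrable_min_inner_sq_stdGaussian (v : E) :
    Integrable (fun g => min ⟪v, g⟫ 0 ^ 2) (stdGaussian E) := by
  refine (integrable_inner_sq_stdGaussian v).mono (by fun_prop)
    (Filter.Eventually.of_forall fun g => ?_)
  rw [Real.norm_of_nonneg (by positivity), Real.norm_of_nonneg (by positivity)]
  rcases le_total ⟪v, g⟫ 0 with h | h
  · rw [min_eq_left h]
  · rw [min_eq_right h, zero_pow two_ne_zero]; positivity

/-- By the symmetry `g ↦ -g`, the negative part of `⟪v, g⟫` carries half of its second moment. -/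
theorem integral_min_inner_sq_stdGaussian (v : E) :
    ∫ g, min ⟪v, g⟫ 0 ^ 2 ∂(stdGaussian E) = ‖v‖ ^ 2 / 2 := by
  have h1 := integral_comp_linearIsometryEquiv_stdGaussian (LinearIsometryEquiv.neg ℝ (E := E))
    (fun g => min ⟪v, g⟫ 0 ^ 2)
  have hi : Integrable (fun g => min ⟪v, -g⟫ 0 ^ 2) (stdGaussian E) := by
    simpa using integrable_min_inner_sq_stdGaussian (-v)
  have h2 : ∫ g, (min ⟪v, g⟫ 0 ^ 2 + min ⟪v, -g⟫ 0 ^ 2) ∂(stdGaussian E) = ‖v‖ ^ 2 := by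
    rw [← integral_inner_sq_stdGaussian v]
    congr with g
    rw [inner_neg_right]
    rcases le_total ⟪v, g⟫ 0 with h | h
    · rw [min_eq_left h, min_eq_right (by linarith)]; ring
    · rw [min_eq_right h, min_eq_left (by linarith)]; ring
  rw [integral_add (integrable_min_inner_sq_stdGaussian v) hi] at h2
  simp only [LinearIsometryEquiv.coe_neg] at h1
  linarith

/-- The bound that integration by parts `E[k(w) ⟪v, w⟫] = E[⟪∇k(w), v⟫]` would give for smooth `k`.
Averaging over the reflection in the hyperplane orthogonal to `v` replaces `k(w)` by half of the
increment of `k` between `w` and its mirror image, so no derivative of `k` is needed. -/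
theorem abs_integral_lipschitz_mul_inner_le {C : ℝ≥0} {k : E → ℝ} (hk : LipschitzWith C k)
    (v : E) : |∫ w, k w * ⟪v, w⟫ ∂(stdGaussian E)| ≤ C * ‖v‖ := by
  rcases eq_or_ne v 0 with rfl | hv
  · simp
  have hv' : 0 < ‖v‖ := norm_pos_iff.2 hv
  set R : E ≃ₗᵢ[ℝ] E := (ℝ ∙ v)ᗮ.reflection with hR
  have hRw : ∀ w, R w = w - (2 * (⟪v, w⟫ / ‖v‖ ^ 2)) • v := by
    intro w
    rw [hR, Submodule.reflection_orthogonal_apply, Submodule.reflection_singleton_apply]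
    simp only [RCLike.ofReal_real_eq_id, id_eq]
    rw [neg_sub, two_smul, two_mul, add_smul]
  have hvR : ∀ w, ⟪v, R w⟫ = -⟪v, w⟫ := by
    intro w
    rw [hRw, inner_sub_right, real_inner_smul_right, real_inner_self_eq_norm_sq]
    field_simp
    ring
  have hint : ∀ {k : E → ℝ}, LipschitzWith C k →
      Integrable (fun w => k w * ⟪v, w⟫) (stdGaussian E) := fun hk =>
    (memLp_lipschitz_stdGaussian hk).integrable_mul
      (IsGaussian.memLp_dual (stdGaussian E) (innerSL ℝ v) 2 (by simp))
  have hkR : LipschitzWith C fun w => k (R w) := by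
    have := hk.comp R.lipschitz
    rwa [mul_one] at this
  have h1 := integral_comp_linearIsometryEquiv_stdGaussian R (fun w => k w * ⟪v, w⟫)
  simp only [hvR, mul_neg, integral_neg] at h1
  have h2 : 2 * ∫ w, k w * ⟪v, w⟫ ∂(stdGaussian E) =
      ∫ w, (k w * ⟪v, w⟫ - k (R w) * ⟪v, w⟫) ∂(stdGaussian E) := by
    rw [integral_sub (hint hk) (hint hkR)]
    linarith
  have h3 : |∫ w, (k w * ⟪v, w⟫ - k (R w) * ⟪v, w⟫) ∂(stdGaussian E)| ≤
      ∫ w, (2 * C / ‖v‖) * ⟪v, w⟫ ^ 2 ∂(stdGaussian E) := by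
    rw [← Real.norm_eq_abs]
    refine norm_integral_le_of_norm_le ((integrable_inner_sq_stdGaussian v).const_mul _)
      (Filter.Eventually.of_forall fun w => ?_)
    have h4 := hk.norm_sub_le w (R w)
    rw [hRw w, sub_sub_cancel, norm_smul, ← hRw w] at h4
    have h5 : ‖2 * (⟪v, w⟫ / ‖v‖ ^ 2)‖ = 2 * (|⟪v, w⟫| / ‖v‖ ^ 2) := by
      simp
    rw [h5] at h4
    rw [← sub_mul, norm_mul, Real.norm_eq_abs ⟪v, w⟫]
    calc ‖k w - k (R w)‖ * |⟪v, w⟫|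
        ≤ (C * (2 * (|⟪v, w⟫| / ‖v‖ ^ 2) * ‖v‖)) * |⟪v, w⟫| := by gcongr
      _ = 2 * C / ‖v‖ * ⟪v, w⟫ ^ 2 := by
          rw [← sq_abs ⟪v, w⟫]; field_simp
  rw [integral_const_mul, integral_inner_sq_stdGaussian, ← h2, abs_mul, abs_two] at h3
  have : 2 * ↑C / ‖v‖ * ‖v‖ ^ 2 = 2 * (C * ‖v‖) := by field_simp
  linarith

/-- The Gaussian covariance inequality `Cov(h, f) ≤ Lip(f) Lip(h)`; for `h = f` it is the Poincaré
inequality with its sharp constant. For independent standard Gaussian `x`, `y`, the function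
`F θ = E[h(x) f(cos θ x + sin θ y)]` runs from `E[h f]` at `θ = 0` to `E[h] E[f]` at `θ = π / 2`.
Since the joint law of `(x, y)` is invariant under rotations, its derivative at `θ` is
`E[h(cos θ z - sin θ w) ⟪∇f(z), w⟫]` with independent `z`, `w`, which is at most
`Lip(f) Lip(h) |sin θ|` in absolute value. -/
theorem integral_mul_sub_integral_mul_integral_le {Cf Ch : ℝ≥0} {f h : E → ℝ}
    (hf : LipschitzWith Cf f) (hh : LipschitzWith Ch h) :
    ∫ g, h g * f g ∂(stdGaussian E) -
      (∫ g, h g ∂(stdGaussian E)) * ∫ g, f g ∂(stdGaussian E) ≤ Cf * Ch := by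
  set γ := stdGaussian E with hγ
  have hrot : ∀ θ, (γ.prod γ).map (ContinuousLinearMap.rotation θ) = γ.prod γ :=
    IsGaussian.map_rotation_eq_self (by simp [hγ])
  have hdiff : ∀ θ, ∀ᵐ p ∂(γ.prod γ),
      DifferentiableAt ℝ f (Real.cos θ • p.1 + Real.sin θ • p.2) := by
    intro θ
    have h1 : ∀ᵐ z ∂γ, DifferentiableAt ℝ f z :=
      stdGaussian_absolutelyContinuous.ae_le hf.ae_differentiableAt
    have h2 : ∀ᵐ p ∂(γ.prod γ), DifferentiableAt ℝ f p.1 :=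
      Measure.quasiMeasurePreserving_fst.ae h1
    rw [← hrot θ] at h2
    have := ae_of_ae_map (by fun_prop) h2
    simpa [ContinuousLinearMap.rotation_apply] using this
  have hgrad : Measurable (gradient f) :=
    (InnerProductSpace.toDual ℝ E).symm.continuous.measurable.comp (measurable_fderiv ℝ f)
  have hgradle : ∀ z, ‖gradient f z‖ ≤ Cf := fun z => by
    rw [gradient, LinearIsometryEquiv.norm_map]
    exact norm_fderiv_le_of_lipschitz ℝ hf
  have hh2 : MemLp h 2 γ := memLp_lipschitz_stdGaussian hh
  have hf2 : MemLp f 2 γ := memLp_lipschitz_stdGaussian hf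
  have hid : MemLp (fun z : E => ‖z‖) 2 γ := (IsGaussian.memLp_two_id (μ := γ)).norm
  set F : ℝ → ℝ := fun θ =>
    ∫ p : E × E, h p.1 * f (Real.cos θ • p.1 + Real.sin θ • p.2) ∂(γ.prod γ) with hF
  set F' : ℝ → ℝ := fun θ =>
    ∫ p : E × E, h p.1 * ⟪gradient f (Real.cos θ • p.1 + Real.sin θ • p.2),
      -Real.sin θ • p.1 + Real.cos θ • p.2⟫ ∂(γ.prod γ) with hF'
  have hmf : ∀ θ, Measurable fun p : E × E =>
      h p.1 * f (Real.cos θ • p.1 + Real.sin θ • p.2) := fun θ => by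
    have h1 := hh.continuous.measurable
    have h2 := hf.continuous.measurable
    fun_prop
  have hbound : Integrable (fun p : E × E => |h p.1| * (Cf * (‖p.1‖ + ‖p.2‖))) (γ.prod γ) := by
    have h1 : MemLp (fun p : E × E => h p.1) 2 (γ.prod γ) := hh2.comp_fst γ
    have h2 : MemLp (fun p : E × E => Cf * (‖p.1‖ + ‖p.2‖)) 2 (γ.prod γ) :=
      ((hid.comp_fst γ).add (hid.comp_snd γ)).const_mul _
    exact h1.norm.integrable_mul h2
  have hint : ∀ θ, Integrable (fun p : E × E =>
      h p.1 * f (Real.cos θ • p.1 + Real.sin θ • p.2)) (γ.prod γ) := by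
    intro θ
    have h1 : MemLp (fun p : E × E => h p.1) 2 (γ.prod γ) := hh2.comp_fst γ
    have h2 : MemLp (fun p : E × E => f p.1) 2 (γ.prod γ) := hf2.comp_fst γ
    have h3 := (MeasurePreserving.mk (ContinuousLinearMap.rotation θ).continuous.measurable
      (hrot θ))
    have h4 := h2.comp_measurePreserving h3
    exact h1.integrable_mul h4
  have hderiv : ∀ θ, HasDerivAt F (F' θ) θ := by
    intro θ
    refine (hasDerivAt_integral_of_dominated_loc_of_lip (s := Set.univ) Filter.univ_mem
      (Filter.Eventually.of_forall fun θ => (hmf θ).aestronglyMeasurable) (hint θ)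
      ?_ (Filter.Eventually.of_forall fun p => ?_) hbound ?_).2
    · have h1 := hh.continuous.measurable
      exact Measurable.aestronglyMeasurable (by fun_prop)
    · rw [lipschitzOnWith_univ]
      have hd : ∀ t, HasDerivAt (fun t => Real.cos t • p.1 + Real.sin t • p.2)
          (-Real.sin t • p.1 + Real.cos t • p.2) t := fun t =>
        ((Real.hasDerivAt_cos t).smul_const p.1).add ((Real.hasDerivAt_sin t).smul_const p.2)
      have h1 : LipschitzWith (‖p.1‖₊ + ‖p.2‖₊)
          (fun t => Real.cos t • p.1 + Real.sin t • p.2) := by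
        refine lipschitzWith_of_nnnorm_deriv_le (fun t => (hd t).differentiableAt) fun t => ?_
        rw [(hd t).deriv, ← NNReal.coe_le_coe]
        refine (norm_add_le _ _).trans ?_
        rw [norm_smul, norm_smul, norm_neg]
        push_cast
        have := mul_le_mul_of_nonneg_right (Real.abs_sin_le_one t) (norm_nonneg p.1)
        have := mul_le_mul_of_nonneg_right (Real.abs_cos_le_one t) (norm_nonneg p.2)
        simp only [Real.norm_eq_abs]
        linarith
      have h2 := (lipschitzWith_smul (h p.1)).comp (hf.comp h1)
      refine h2.weaken ?_
      rw [← NNReal.coe_le_coe]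
      simp only [NNReal.coe_mul, NNReal.coe_add, coe_nnnorm, Real.norm_eq_abs, Real.coe_nnabs]
      exact le_abs_self _
    · filter_upwards [hdiff θ] with p hp
      have hd : HasDerivAt (fun t => Real.cos t • p.1 + Real.sin t • p.2)
          (-Real.sin θ • p.1 + Real.cos θ • p.2) θ :=
        ((Real.hasDerivAt_cos θ).smul_const p.1).add ((Real.hasDerivAt_sin θ).smul_const p.2)
      have := (hp.hasGradientAt.hasFDerivAt.comp_hasDerivAt θ hd).const_mul (h p.1)
      simpa using this
  have hF'le : ∀ θ, |F' θ| ≤ Cf * Ch * |Real.sin θ| := by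
    intro θ
    -- rotate: with `(z, w)` the image of `(x, y)`, one has `x = cos θ z - sin θ w`
    have h1 : F' θ = ∫ q : E × E, h (Real.cos θ • q.1 - Real.sin θ • q.2) *
        ⟪gradient f q.1, q.2⟫ ∂(γ.prod γ) := by
      have hm : Measurable fun q : E × E => h (Real.cos θ • q.1 - Real.sin θ • q.2) *
        ⟪gradient f q.1, q.2⟫ := by
        have h1 := hh.continuous.measurable
        fun_prop
      conv_rhs => rw [← hrot θ]
      rw [integral_map (by fun_prop) hm.aestronglyMeasurable, hF']
      refine integral_congr_ae (Filter.Eventually.of_forall fun p => ?_)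
      simp only [ContinuousLinearMap.rotation_apply]
      congr 2
      rw [smul_add, smul_add, smul_smul, smul_smul, smul_smul, smul_smul]
      have := Real.cos_sq_add_sin_sq θ
      match_scalars <;> linarith
    rw [h1, ← Real.norm_eq_abs]
    -- if the integrand were not integrable, the integral would be `0` and the bound trivial
    by_cases hi : Integrable (fun q : E × E => h (Real.cos θ • q.1 - Real.sin θ • q.2) *
        ⟪gradient f q.1, q.2⟫) (γ.prod γ)
    · rw [integral_prod _ hi]
      refine (norm_integral_le_of_norm_le_const
        (C := Cf * Ch * |Real.sin θ|) (Filter.Eventually.of_forall fun z => ?_)).trans (by simp)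
      have hl : LipschitzWith (Ch * ‖Real.sin θ‖₊)
          fun w => h (Real.cos θ • z - Real.sin θ • w) := by
        refine hh.comp (LipschitzWith.of_dist_le_mul fun x y => ?_)
        simp [dist_eq_norm, ← smul_sub, norm_smul, norm_sub_rev]
      have h2 := abs_integral_lipschitz_mul_inner_le hl (gradient f z)
      have h3 := mul_le_mul_of_nonneg_left (hgradle z) (Ch * ‖Real.sin θ‖₊).2
      simp only [NNReal.val_eq_coe, NNReal.coe_mul, coe_nnnorm, Real.norm_eq_abs] at h2 h3 ⊢
      linarith
    · rw [integral_undef hi, norm_zero]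
      positivity
  have hmono : MonotoneOn (fun θ => F θ - Cf * Ch * Real.cos θ) (Set.Icc 0 (Real.pi / 2)) := by
    have hd : ∀ θ, HasDerivAt (fun θ => F θ - Cf * Ch * Real.cos θ)
        (F' θ - Cf * Ch * (-Real.sin θ)) θ := fun θ =>
      (hderiv θ).sub ((Real.hasDerivAt_cos θ).const_mul _)
    refine monotoneOn_of_deriv_nonneg (convex_Icc _ _)
      (fun θ _ => (hd θ).continuousAt.continuousWithinAt)
      (fun θ _ => (hd θ).differentiableAt.differentiableWithinAt) fun θ hθ => ?_
    rw [interior_Icc] at hθ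
    rw [(hd θ).deriv]
    have h1 := hF'le θ
    rw [abs_of_nonneg (Real.sin_nonneg_of_nonneg_of_le_pi hθ.1.le
      (by linarith [hθ.2, Real.pi_pos]))] at h1
    have h2 := neg_abs_le (F' θ)
    linarith
  have hpi := Real.pi_pos
  have h0 := hmono (Set.left_mem_Icc.2 (by positivity)) (Set.right_mem_Icc.2 (by positivity))
    (by positivity : (0 : ℝ) ≤ Real.pi / 2)
  have hF0 : F 0 = ∫ g, h g * f g ∂γ := by
    simp only [hF, Real.cos_zero, Real.sin_zero, one_smul, zero_smul, add_zero]
    have := integral_fun_fst (μ := γ) (ν := γ) (fun g => h g * f g)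
    simpa using this
  have hF1 : F (Real.pi / 2) = (∫ g, h g ∂γ) * ∫ g, f g ∂γ := by
    simp only [hF, Real.cos_pi_div_two, Real.sin_pi_div_two, one_smul, zero_smul, zero_add]
    exact integral_prod_mul h f
  simp only [Real.cos_zero, Real.cos_pi_div_two, hF0, hF1] at h0
  linarith

end Gaussian

/-! ### Distances to the dilations of a convex set and to its cone -/

section Convex

open scoped NNReal RealInnerProductSpace

theorem exists_nearest_point_map {E : Type*} [NormedAddCommGroup E] [InnerProductSpace ℝ E]
    [CompleteSpace E] {K : Set E} (hne : K.Nonempty) (hcl : IsClosed K) (hconv : Convex ℝ K) :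
    ∃ P : E → E, (∀ g, P g ∈ K) ∧ (∀ g, Metric.infDist g K = ‖g - P g‖) ∧
      ∀ g, ∀ z ∈ K, ⟪g - P g, z - P g⟫ ≤ 0 := by
  choose P hP hPd using exists_norm_eq_iInf_of_complete_convex hne hcl.isComplete hconv
  refine ⟨P, hP, fun g => ?_, fun g => (norm_eq_iInf_iff_real_inner_le_zero hconv (hP g)).1 (hPd g)⟩
  rw [hPd g, Metric.infDist_eq_iInf]
  simp only [dist_eq_norm]

/-- Firm nonexpansiveness of the metric projection: `p` and `q` play the role of the projections of
`g` and `h` onto a convex set, which enters only through the obtuse angle criterion. -/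
theorem norm_sub_sq_le_inner_of_obtuse {E : Type*} [NormedAddCommGroup E] [InnerProductSpace ℝ E]
    {g h p q : E} (hg : ⟪g - p, q - p⟫ ≤ 0) (hh : ⟪h - q, p - q⟫ ≤ 0) :
    ‖p - q‖ ^ 2 ≤ ⟪p - q, g - h⟫ := by
  rw [← real_inner_self_eq_norm_sq]
  simp only [inner_sub_left, inner_sub_right] at *
  rw [real_inner_comm g q, real_inner_comm h p, real_inner_comm g p, real_inner_comm h q] at *
  linarith

theorem norm_sub_le_of_obtuse {E : Type*} [NormedAddCommGroup E] [InnerProductSpace ℝ E]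
    {g h p q : E} (hg : ⟪g - p, q - p⟫ ≤ 0) (hh : ⟪h - q, p - q⟫ ≤ 0) :
    ‖p - q‖ ≤ ‖g - h‖ := by
  have h1 := norm_sub_sq_le_inner_of_obtuse hg hh
  have h2 := real_inner_le_norm (p - q) (g - h)
  by_contra! hlt
  nlinarith [norm_nonneg (g - h)]

theorem norm_sub_sub_sub_le_of_obtuse {E : Type*} [NormedAddCommGroup E] [InnerProductSpace ℝ E]
    {g h p q : E} (hg : ⟪g - p, q - p⟫ ≤ 0) (hh : ⟪h - q, p - q⟫ ≤ 0) :
    ‖(g - p) - (h - q)‖ ≤ ‖g - h‖ := by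
  have h1 := norm_sub_sq_le_inner_of_obtuse hg hh
  have h2 : (g - p) - (h - q) = (g - h) - (p - q) := by abel
  refine le_of_sq_le_sq ?_ (norm_nonneg _)
  rw [h2, norm_sub_sq_real, real_inner_comm]
  nlinarith [sq_nonneg ‖p - q‖]

/-- The support function `v ↦ max_{s ∈ S} ⟪v, s⟫` of a compact set of radius `σ`. -/
theorem exists_lipschitz_support_function {E : Type*} [NormedAddCommGroup E]
    [InnerProductSpace ℝ E] {S : Set E} (hne : S.Nonempty) (hS : IsCompact S) {σ : ℝ}
    (hσ : ∀ s ∈ S, ‖s‖ ≤ σ) :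
    ∃ H : E → ℝ, LipschitzWith σ.toNNReal H ∧ (∀ v, ∀ s ∈ S, ⟪v, s⟫ ≤ H v) ∧
      ∀ v, ∃ s ∈ S, H v = ⟪v, s⟫ := by
  have hex : ∀ v : E, ∃ p ∈ S, ∀ s ∈ S, ⟪v, s⟫ ≤ ⟪v, p⟫ := fun v =>
    hS.exists_isMaxOn hne (by fun_prop : Continuous fun s => ⟪v, s⟫).continuousOn
  choose p hp hmax using hex
  refine ⟨fun v => ⟪v, p v⟫, LipschitzWith.of_le_add_mul' σ fun v v' => ?_, hmax,
    fun v => ⟨p v, hp v, rfl⟩⟩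
  have h1 := hmax v' (p v) (hp v)
  have h2 := real_inner_le_norm (v - v') (p v)
  have h3 := mul_le_mul_of_nonneg_left (hσ _ (hp v)) (norm_nonneg (v - v'))
  rw [inner_sub_left] at h2
  rw [dist_eq_norm]
  linarith

variable {ι : Type*} [Fintype ι] {S : Set (EuclideanSpace ℝ ι)}

theorem coneOf_nonempty (hne : S.Nonempty) : (coneOf S).Nonempty := by
  obtain ⟨s, hs⟩ := hne
  exact ⟨_, 0, le_rfl, s, hs, rfl⟩

theorem convex_coneOf (hconv : Convex ℝ S) : Convex ℝ (coneOf S) := by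
  rw [convex_iff_forall_pos]
  rintro _ ⟨c, hc, x, hx, rfl⟩ _ ⟨d, hd, y, hy, rfl⟩ a b ha hb -
  rcases (add_nonneg (mul_nonneg ha.le hc) (mul_nonneg hb.le hd)).eq_or_lt with h | h
  · have h1 : a * c = 0 := by nlinarith [mul_nonneg ha.le hc, mul_nonneg hb.le hd]
    have h2 : b * d = 0 := by linarith
    exact ⟨0, le_rfl, x, hx, by rw [smul_smul, smul_smul, h1, h2]; simp⟩
  · refine ⟨a * c + b * d, h.le, (a * c / (a * c + b * d)) • x + (b * d / (a * c + b * d)) • y,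
      hconv hx hy (by positivity) (by positivity) (by field_simp), ?_⟩
    rw [smul_add, smul_smul, smul_smul, smul_smul, smul_smul]
    field_simp

/-- If the linear functional `⟪e, ·⟫` is a positive constant `ρ` on `S`, the scale of a point `z` of the
cone is recovered continuously as `⟪e, z⟫ / ρ`. -/
theorem isClosed_coneOf (hS : IsCompact S) {e : EuclideanSpace ℝ ι} {ρ : ℝ} (hρ : 0 < ρ)
    (he : ∀ s ∈ S, ⟪e, s⟫ = ρ) : IsClosed (coneOf S) := by
  refine isSeqClosed_iff_isClosed.1 fun z y hz hy => ?_
  choose c hc s hs hcs using hz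
  have hcn : ∀ n, c n = ⟪e, z n⟫ / ρ := fun n => by
    rw [hcs n, real_inner_smul_right, he _ (hs n)]
    field_simp
  have hclim : Filter.Tendsto c Filter.atTop (nhds (⟪e, y⟫ / ρ)) := by
    rw [funext hcn]
    exact (tendsto_const_nhds.inner hy).div_const ρ
  obtain ⟨t, ht, φ, hφ, hst⟩ := hS.tendsto_subseq hs
  refine ⟨⟪e, y⟫ / ρ, ge_of_tendsto' hclim hc, t, ht, ?_⟩
  refine tendsto_nhds_unique (hy.comp hφ.tendsto_atTop) ?_
  have := (hclim.comp hφ.tendsto_atTop).smul hst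
  refine this.congr fun n => ?_
  simp [hcs]

theorem smul_set_subset_coneOf {c : ℝ} (hc : 0 ≤ c) : c • S ⊆ coneOf S := by
  rintro _ ⟨s, hs, rfl⟩
  exact ⟨c, hc, s, hs, rfl⟩

theorem msd_coneOf_le_msd_smul (hne : S.Nonempty) {c : ℝ} (hc : 0 ≤ c) :
    msd (coneOf S) ≤ msd (c • S) := by
  refine integral_mono (integrable_infDist_sq _) (integrable_infDist_sq _) fun g => ?_
  have := Metric.infDist_le_infDist_of_subset (x := g) (smul_set_subset_coneOf (S := S) hc)
    (hne.smul_set)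
  have h0 : 0 ≤ Metric.infDist g (coneOf S) := Metric.infDist_nonneg
  gcongr

/-- A single well-chosen dilation of `S` is almost as close to a Gaussian vector as the cone. The
projection of `g` onto the cone has the form `τ g • s` with `s ∈ S`, and the dilation used is the mean
`t` of `τ`. Convexity bounds `dist(g, t • S)² - dist(g, cone S)²` by `2 (τ g - t) H(u g)`, where `H` is
the support function of `S` and `u g` the residual of the projection of `g` onto `t • S`. Both `τ` and
`H ∘ u` are Lipschitz, with constants `1 / ρ` and `σ`, so the expectation, which is twice a covariance,
is at most `2 σ / ρ`. -/
theorem exists_msd_smul_le_msd_coneOf_add (hne : S.Nonempty) (hcl : IsClosed S)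
    (hconv : Convex ℝ S) {σ : ℝ} (hσ : ∀ s ∈ S, ‖s‖ ≤ σ) {e : EuclideanSpace ℝ ι}
    (he1 : ‖e‖ = 1) {ρ : ℝ} (hρ : 0 < ρ) (he : ∀ s ∈ S, ⟪e, s⟫ = ρ) :
    ∃ c : ℝ, 0 ≤ c ∧ msd (c • S) ≤ msd (coneOf S) + 2 * (σ / ρ) := by
  have hS : IsCompact S := Metric.isCompact_of_isClosed_isBounded hcl
    (isBounded_iff_forall_norm_le.2 ⟨σ, hσ⟩)
  have hσ0 : 0 ≤ σ := by
    obtain ⟨s, hs⟩ := hne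
    exact (norm_nonneg s).trans (hσ s hs)
  obtain ⟨P, hP, hPd, hPo⟩ := exists_nearest_point_map (coneOf_nonempty hne) (isClosed_coneOf hS hρ he)
    (convex_coneOf hconv)
  obtain ⟨H, hHlip, hHle, hHeq⟩ := exists_lipschitz_support_function hne hS hσ
  set τ : EuclideanSpace ℝ ι → ℝ := fun g => ⟪e, P g⟫ / ρ with hτ
  have hτP : ∀ g, ∃ s ∈ S, 0 ≤ τ g ∧ P g = τ g • s := by
    intro g
    obtain ⟨c, hc, s, hs, h⟩ := hP g
    have : τ g = c := by
      rw [hτ]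
      simp only
      rw [h, real_inner_smul_right, he s hs]
      field_simp
    exact ⟨s, hs, this ▸ hc, this ▸ h⟩
  have hτlip : LipschitzWith (ρ⁻¹).toNNReal τ := by
    refine LipschitzWith.of_le_add_mul' _ fun g h => ?_
    have h1 := norm_sub_le_of_obtuse (hPo g _ (hP h)) (hPo h _ (hP g))
    have h2 := real_inner_le_norm e (P g - P h)
    rw [he1, one_mul, inner_sub_right] at h2
    rw [dist_eq_norm, hτ]
    simp only
    rw [div_le_iff₀ hρ, add_mul, div_mul_cancel₀ _ hρ.ne']
    field_simp
    linarith
  set t : ℝ := ∫ g, τ g ∂(stdGaussian (EuclideanSpace ℝ ι)) with ht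
  have ht0 : 0 ≤ t := integral_nonneg fun g => (hτP g).choose_spec.2.1
  obtain ⟨Q, hQ, hQd, hQo⟩ := exists_nearest_point_map (K := t • S) hne.smul_set
    (hS.smul t).isClosed (hconv.smul t)
  have hHQ : LipschitzWith σ.toNNReal fun g => H (g - Q g) := by
    have h1 : LipschitzWith 1 fun g => g - Q g := LipschitzWith.of_dist_le_mul fun g h => by
      rw [dist_eq_norm, dist_eq_norm, NNReal.coe_one, one_mul]
      exact norm_sub_sub_sub_le_of_obtuse (hQo g _ (hQ h)) (hQo h _ (hQ g))
    have := hHlip.comp h1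
    rwa [mul_one] at this
  refine ⟨t, ht0, ?_⟩
  -- first-order lower bound for the convex function `c ↦ dist(g, c • S)²` at `c = t`
  have hpt : ∀ g, Metric.infDist g (t • S) ^ 2 ≤
      Metric.infDist g (coneOf S) ^ 2 + 2 * (τ g * H (g - Q g) - t * H (g - Q g)) := by
    intro g
    obtain ⟨s, hs, hc, hPs⟩ := hτP g
    obtain ⟨s₀, hs₀, hQs⟩ := hQ g
    obtain ⟨p, hp, hHp⟩ := hHeq (g - Q g)
    have h1 := hQo g (t • p) (Set.smul_mem_smul_set hp)
    have h2 := mul_le_mul_of_nonneg_left (hHle (g - Q g) s hs) hc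
    rw [inner_sub_right, real_inner_smul_right, ← hHp] at h1
    have h3 : g - P g = (g - Q g) + (Q g - τ g • s) := by rw [hPs]; abel
    rw [hPd, hQd, h3, norm_add_sq_real, inner_sub_right, real_inner_smul_right]
    nlinarith [sq_nonneg ‖Q g - τ g • s‖]
  have hτ2 := memLp_lipschitz_stdGaussian hτlip
  have hH2 := memLp_lipschitz_stdGaussian hHQ
  have hi1 : Integrable (fun g => τ g * H (g - Q g)) (stdGaussian (EuclideanSpace ℝ ι)) :=
    hτ2.integrable_mul hH2
  have hi2 : Integrable (fun g => t * H (g - Q g)) (stdGaussian (EuclideanSpace ℝ ι)) :=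
    (hH2.integrable (by norm_num)).const_mul t
  have hi3 : Integrable (fun g => 2 * (τ g * H (g - Q g) - t * H (g - Q g)))
      (stdGaussian (EuclideanSpace ℝ ι)) := (hi1.sub hi2).const_mul 2
  have hcov := integral_mul_sub_integral_mul_integral_le hHQ hτlip
  rw [Real.coe_toNNReal _ hσ0, Real.coe_toNNReal _ (by positivity)] at hcov
  calc msd (t • S) ≤ ∫ g, (Metric.infDist g (coneOf S) ^ 2 +
        2 * (τ g * H (g - Q g) - t * H (g - Q g))) ∂(stdGaussian (EuclideanSpace ℝ ι)) :=
        integral_mono (integrable_infDist_sq _)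
          ((integrable_infDist_sq _).add hi3) hpt
    _ = msd (coneOf S) + 2 * ((∫ g, τ g * H (g - Q g) ∂(stdGaussian (EuclideanSpace ℝ ι))) -
        t * ∫ g, H (g - Q g) ∂(stdGaussian (EuclideanSpace ℝ ι))) := by
        rw [integral_add (integrable_infDist_sq _) hi3, integral_const_mul, integral_sub hi1 hi2, integral_const_mul]
        rfl
    _ ≤ msd (coneOf S) + 2 * (σ / ρ) := by
        rw [div_eq_mul_inv]
        linarith

theorem infDist_smul_le_add {σ : ℝ} (hσ : ∀ s ∈ S, ‖s‖ ≤ σ) (hne : S.Nonempty) (c d : ℝ)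
    (g : EuclideanSpace ℝ ι) :
    Metric.infDist g (c • S) ≤ Metric.infDist g (d • S) + σ * dist c d := by
  rw [← sub_le_iff_le_add, Metric.le_infDist hne.smul_set]
  rintro _ ⟨s, hs, rfl⟩
  have h1 := Metric.infDist_le_dist_of_mem (x := g) (Set.smul_mem_smul_set (a := c) hs)
  have h2 := dist_triangle g (d • s) (c • s)
  have h3 : dist (d • s) (c • s) ≤ σ * dist c d := by
    rw [dist_eq_norm, ← sub_smul, norm_smul, mul_comm, dist_comm, Real.dist_eq]
    exact mul_le_mul_of_nonneg_right (hσ s hs) (abs_nonneg _)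
  simp only at h2 ⊢
  linarith

theorem continuous_msd_smul (hne : S.Nonempty) {σ : ℝ} (hσ : ∀ s ∈ S, ‖s‖ ≤ σ) :
    Continuous fun c : ℝ => msd (c • S) := by
  have hσ0 : 0 ≤ σ := by
    obtain ⟨s, hs⟩ := hne
    exact (norm_nonneg s).trans (hσ s hs)
  refine continuous_iff_continuousAt.2 fun c => ?_
  refine continuousAt_of_dominated
    (bound := fun g => (Metric.infDist g (c • S) + σ) ^ 2)
    (Filter.Eventually.of_forall fun d => (integrable_infDist_sq _).aestronglyMeasurable) ?_ ?_
    (Filter.Eventually.of_forall fun g => ?_)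
  · filter_upwards [Metric.ball_mem_nhds c one_pos] with d hd
    refine Filter.Eventually.of_forall fun g => ?_
    have h1 := infDist_smul_le_add hσ hne d c g
    have h0 : 0 ≤ Metric.infDist g (d • S) := Metric.infDist_nonneg
    have h2 := mul_le_mul_of_nonneg_left (Metric.mem_ball.1 hd).le hσ0
    rw [Real.norm_of_nonneg (by positivity)]
    gcongr
    linarith
  · have hid : MemLp id 2 (stdGaussian (EuclideanSpace ℝ ι)) := IsGaussian.memLp_two_id
    have h1 : LipschitzWith 1 fun g => Metric.infDist g (c • S) + σ := by
      have := (Metric.lipschitz_infDist_pt (c • S)).add (LipschitzWith.const σ)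
      rwa [add_zero] at this
    exact (memLp_lipschitz_stdGaussian h1).integrable_sq
  · have : LipschitzWith σ.toNNReal fun d : ℝ => Metric.infDist g (d • S) :=
      LipschitzWith.of_le_add_mul' _ fun a b => infDist_smul_le_add hσ hne a b g
    exact (this.continuous.pow 2).continuousAt

theorem le_msd (hne : S.Nonempty) {B : EuclideanSpace ℝ ι → ℝ}
    (hB : Integrable B (stdGaussian (EuclideanSpace ℝ ι)))
    (hle : ∀ g, ∀ s ∈ S, B g ≤ ‖g - s‖ ^ 2) :
    ∫ g, B g ∂(stdGaussian (EuclideanSpace ℝ ι)) ≤ msd S := by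
  refine integral_mono hB (integrable_infDist_sq _) fun g => ?_
  have h : √(B g) ≤ Metric.infDist g S := by
    rw [Metric.le_infDist hne]
    intro s hs
    rw [dist_eq_norm]
    exact Real.sqrt_le_iff.2 ⟨norm_nonneg _, hle g s hs⟩
  calc B g ≤ √(B g) ^ 2 := by
        rcases le_total 0 (B g) with h0 | h0
        · rw [Real.sq_sqrt h0]
        · exact h0.trans (sq_nonneg _)
    _ ≤ _ := by gcongr

theorem msd_zero_smul (hne : S.Nonempty) : msd ((0 : ℝ) • S) = Fintype.card ι := by
  rw [Set.zero_smul_set hne, msd]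
  have h : ∀ g : EuclideanSpace ℝ ι, Metric.infDist g 0 ^ 2 =
      ∑ i, ⟪EuclideanSpace.basisFun ι ℝ i, g⟫ ^ 2 := fun g => by
    rw [← Set.singleton_zero, Metric.infDist_singleton, dist_zero_right,
      OrthonormalBasis.sum_sq_inner_right]
  simp_rw [h]
  rw [integral_finsetSum _ fun i _ => integrable_inner_sq_stdGaussian _]
  simp_rw [integral_inner_sq_stdGaussian]
  simp

/-- Coercivity of `c ↦ msd (c • S)`: only the component along `e` is kept. -/
theorem sq_mul_le_msd_smul (hne : S.Nonempty) {e : EuclideanSpace ℝ ι}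
    (he1 : ‖e‖ = 1) {ρ : ℝ} (he : ∀ s ∈ S, ⟪e, s⟫ = ρ) (c : ℝ) :
    c ^ 2 * ρ ^ 2 ≤ msd (c • S) := by
  have hint : Integrable (fun g => ⟪e, g⟫) (stdGaussian (EuclideanSpace ℝ ι)) :=
    IsGaussian.integrable_dual _ (innerSL ℝ e)
  have hzero : ∫ g, ⟪e, g⟫ ∂(stdGaussian (EuclideanSpace ℝ ι)) = 0 :=
    integral_strongDual_stdGaussian (innerSL ℝ e)
  have h1 : Integrable (fun g => (⟪e, g⟫ - c * ρ) ^ 2) (stdGaussian (EuclideanSpace ℝ ι)) :=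
    ((IsGaussian.memLp_dual _ (innerSL ℝ e) 2 (by simp)).sub (memLp_const _)).integrable_sq
  have h2 := le_msd (S := c • S) hne.smul_set h1 ?_
  · have h3 : ∀ g, (⟪e, g⟫ - c * ρ) ^ 2 =
        ⟪e, g⟫ ^ 2 + (c ^ 2 * ρ ^ 2 - 2 * (c * ρ) * ⟪e, g⟫) := fun g => by ring
    simp_rw [h3] at h2
    have h4 : Integrable (fun g => c ^ 2 * ρ ^ 2 - 2 * (c * ρ) * ⟪e, g⟫)
        (stdGaussian (EuclideanSpace ℝ ι)) := (integrable_const _).sub (hint.const_mul _)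
    rw [integral_add (integrable_inner_sq_stdGaussian e) h4, integral_inner_sq_stdGaussian,
      integral_sub (integrable_const _) (hint.const_mul _), integral_const_mul _ fun g => ⟪e, g⟫,
      hzero, he1] at h2
    simp at h2
    linarith
  · rintro g _ ⟨s, hs, rfl⟩
    have h3 : ⟪e, g⟫ - c * ρ = ⟪e, g - c • s⟫ := by
      rw [inner_sub_right, real_inner_smul_right, he s hs]
    simp only
    rw [h3]
    have h4 := abs_real_inner_le_norm e (g - c • s)
    rw [he1, one_mul] at h4
    exact sq_le_sq' (by linarith [neg_abs_le ⟪e, g - c • s⟫]) ((le_abs_self _).trans h4)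

/-- Beyond `M = √(msd 0) / ρ` no dilation can beat `c = 0`, so the minimum is over a compact interval. -/
theorem exists_isLeast_msd_smul (hne : S.Nonempty) {σ : ℝ} (hσ : ∀ s ∈ S, ‖s‖ ≤ σ)
    {e : EuclideanSpace ℝ ι} (he1 : ‖e‖ = 1) {ρ : ℝ} (hρ : 0 < ρ) (he : ∀ s ∈ S, ⟪e, s⟫ = ρ) :
    ∃ m : ℝ, IsLeast {D | ∃ c : ℝ, 0 ≤ c ∧ D = msd (c • S)} m := by
  set M : ℝ := √(msd ((0 : ℝ) • S)) / ρ with hM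
  have hM0 : 0 ≤ M := by positivity
  obtain ⟨c, hc, hmin⟩ := isCompact_Icc.exists_isMinOn (Set.nonempty_Icc.2 hM0)
    (continuous_msd_smul hne hσ).continuousOn
  refine ⟨msd (c • S), ⟨c, hc.1, rfl⟩, ?_⟩
  rintro _ ⟨d, hd, rfl⟩
  rcases le_total d M with h | h
  · exact hmin ⟨hd, h⟩
  · refine (hmin (Set.left_mem_Icc.2 hM0)).trans (le_trans ?_ (sq_mul_le_msd_smul hne he1 he d))
    have h1 : √(msd ((0 : ℝ) • S)) ≤ d * ρ := by
      rwa [hM, div_le_iff₀ hρ] at h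
    rw [← mul_pow]
    exact (Real.sqrt_le_left (by positivity)).1 h1

end Convex

/-! ### Sets with a common projection onto an orthonormal family -/

section Sandwich

open scoped NNReal RealInnerProductSpace

variable {ι κ : Type*} [Fintype ι] [Fintype κ] {S : Set (EuclideanSpace ℝ ι)}
  {w : κ → EuclideanSpace ℝ ι} {c : κ → ℝ} {ρ : ℝ}

/-- If every `s ∈ S` satisfies `⟪w a, s⟫ = c a` for an orthonormal family `w`, then all of `S` has the
same projection `∑ a, c a • w a` onto the span of `w`, of norm `ρ = √(∑ a, c a ^ 2)`. This is the unit
vector in that direction. -/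
noncomputable def commonDirection (w : κ → EuclideanSpace ℝ ι) (c : κ → ℝ) (ρ : ℝ) :
    EuclideanSpace ℝ ι :=
  ρ⁻¹ • ∑ a, c a • w a

theorem inner_commonDirection (g : EuclideanSpace ℝ ι) :
    ⟪commonDirection w c ρ, g⟫ = ρ⁻¹ * ∑ a, c a * ⟪w a, g⟫ := by
  rw [commonDirection, real_inner_smul_left, sum_inner]
  simp_rw [real_inner_smul_left]

theorem inner_commonDirection_of_mem (hρ : 0 < ρ) (hc : ∀ a, ∀ s ∈ S, ⟪w a, s⟫ = c a)
    (hcρ : ∑ a, c a ^ 2 = ρ ^ 2) {s : EuclideanSpace ℝ ι} (hs : s ∈ S) :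
    ⟪commonDirection w c ρ, s⟫ = ρ := by
  rw [inner_commonDirection]
  simp_rw [hc _ s hs, ← sq]
  rw [hcρ]
  field_simp

theorem norm_commonDirection (hρ : 0 < ρ) (hw : Orthonormal ℝ w)
    (hcρ : ∑ a, c a ^ 2 = ρ ^ 2) : ‖commonDirection w c ρ‖ = 1 := by
  have h1 : ‖∑ a, c a • w a‖ ^ 2 = ρ ^ 2 := by
    rw [← hcρ, ← real_inner_self_eq_norm_sq, hw.inner_sum]
    simp [sq]
  rw [commonDirection, norm_smul, (sq_eq_sq₀ (norm_nonneg _) hρ.le).1 h1, norm_inv,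
    Real.norm_of_nonneg hρ.le, inv_mul_cancel₀ hρ.ne']

/-- The squared distance from `g` to `t • s` within the span of `w`: the component orthogonal to the
common direction does not depend on `t` and `s`. -/
theorem sum_inner_sub_smul_sq (hρ : 0 < ρ) (hc : ∀ a, ∀ s ∈ S, ⟪w a, s⟫ = c a)
    (hcρ : ∑ a, c a ^ 2 = ρ ^ 2) (g : EuclideanSpace ℝ ι) (t : ℝ) {s : EuclideanSpace ℝ ι}
    (hs : s ∈ S) :
    ∑ a, ⟪w a, g - t • s⟫ ^ 2 = ∑ a, ⟪w a, g⟫ ^ 2 - ⟪commonDirection w c ρ, g⟫ ^ 2 +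
      (⟪commonDirection w c ρ, g⟫ - t * ρ) ^ 2 := by
  have h1 : ∀ a, ⟪w a, g - t • s⟫ ^ 2 =
      ⟪w a, g⟫ ^ 2 - 2 * t * (c a * ⟪w a, g⟫) + t ^ 2 * c a ^ 2 := fun a => by
    rw [inner_sub_right, real_inner_smul_right, hc a s hs]; ring
  simp_rw [h1]
  rw [Finset.sum_add_distrib, Finset.sum_sub_distrib, ← Finset.mul_sum, ← Finset.mul_sum, hcρ,
    inner_commonDirection]
  field_simp
  ring

theorem sum_inner_sq_le (hw : Orthonormal ℝ w) (z : EuclideanSpace ℝ ι) :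
    ∑ a, ⟪w a, z⟫ ^ 2 ≤ ‖z‖ ^ 2 := by
  simpa using hw.sum_inner_products_le (s := Finset.univ) z

theorem sum_inner_sq_add_inner_sq_le (hw : Orthonormal ℝ w) {e : EuclideanSpace ℝ ι}
    (he : ‖e‖ = 1) (hwe : ∀ a, ⟪w a, e⟫ = 0) (z : EuclideanSpace ℝ ι) :
    ∑ a, ⟪w a, z⟫ ^ 2 + ⟪e, z⟫ ^ 2 ≤ ‖z‖ ^ 2 := by
  have h1 := sum_inner_sq_le hw (z - ⟪e, z⟫ • e)
  simp_rw [inner_sub_right, real_inner_smul_right, hwe, mul_zero, sub_zero] at h1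
  rw [norm_sub_sq_real, real_inner_smul_right, norm_smul, he, real_inner_comm e z,
    Real.norm_eq_abs, mul_one, sq_abs] at h1
  linarith

theorem integrable_sum_inner_sq_sub (w : κ → EuclideanSpace ℝ ι) (v : EuclideanSpace ℝ ι) :
    Integrable (fun g => ∑ a, ⟪w a, g⟫ ^ 2 - ⟪v, g⟫ ^ 2)
      (stdGaussian (EuclideanSpace ℝ ι)) :=
  (integrable_finsetSum _ fun _ _ => integrable_inner_sq_stdGaussian _).sub
    (integrable_inner_sq_stdGaussian _)

theorem integral_sum_inner_sq_sub (hw : Orthonormal ℝ w) {v : EuclideanSpace ℝ ι} (hv : ‖v‖ = 1) :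
    ∫ g, (∑ a, ⟪w a, g⟫ ^ 2 - ⟪v, g⟫ ^ 2) ∂(stdGaussian (EuclideanSpace ℝ ι)) =
      Fintype.card κ - 1 := by
  rw [integral_sub (integrable_finsetSum _ fun a _ => integrable_inner_sq_stdGaussian _)
    (integrable_inner_sq_stdGaussian _), integral_finsetSum _ fun a _ =>
    integrable_inner_sq_stdGaussian _, integral_inner_sq_stdGaussian, hv]
  simp_rw [integral_inner_sq_stdGaussian, hw.1]
  simp

/-- Projecting onto the span of `w` turns the cone into a ray, and a ray in dimension `N` has mean
squared distance `N - 1 / 2`. -/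
theorem card_sub_half_le_msd_coneOf (hne : S.Nonempty) (hw : Orthonormal ℝ w) (hρ : 0 < ρ)
    (hc : ∀ a, ∀ s ∈ S, ⟪w a, s⟫ = c a) (hcρ : ∑ a, c a ^ 2 = ρ ^ 2) :
    (Fintype.card κ : ℝ) - 1 / 2 ≤ msd (coneOf S) := by
  set v := commonDirection w c ρ with hv
  have hv1 : ‖v‖ = 1 := norm_commonDirection hρ hw hcρ
  have h := le_msd (coneOf_nonempty hne) ((integrable_sum_inner_sq_sub w v).add
    (integrable_min_inner_sq_stdGaussian v)) ?_
  · simp only [Pi.add_apply] at h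
    rw [integral_add (integrable_sum_inner_sq_sub w v) (integrable_min_inner_sq_stdGaussian v),
      integral_sum_inner_sq_sub hw hv1, integral_min_inner_sq_stdGaussian, hv1] at h
    linarith
  · rintro g _ ⟨t, ht, s, hs, rfl⟩
    refine le_trans ?_ (sum_inner_sq_le hw _)
    rw [sum_inner_sub_smul_sq hρ hc hcρ g t hs, ← hv]
    have h1 : 0 ≤ t * ρ := by positivity
    simp only [Pi.add_apply]
    rcases le_total ⟪v, g⟫ 0 with h | h
    · rw [min_eq_left h]; nlinarith
    · rw [min_eq_right h]; nlinarith [sq_nonneg (⟪v, g⟫ - t * ρ)]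

/-- A lower bound for the squared distance from `(x, y)` to the right-angled cone
`{(p, q) | |q| ≤ p}`, read off in coordinates rotated by `π / 4`. -/
theorem min_sq_add_min_sq_le {x y p q : ℝ} (hpq : |q| ≤ p) :
    (min (x + y) 0 ^ 2 + min (x - y) 0 ^ 2) / 2 ≤ (x - p) ^ 2 + (y - q) ^ 2 := by
  obtain ⟨h1, h2⟩ := abs_le.1 hpq
  have key : ∀ {a b : ℝ}, 0 ≤ b → min a 0 ^ 2 ≤ (a - b) ^ 2 := fun {a b} hb => by
    rcases le_total a 0 with h | h
    · rw [min_eq_left h]; nlinarith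
    · rw [min_eq_right h]; nlinarith [sq_nonneg (a - b)]
  have h3 := key (a := x + y) (b := p + q) (by linarith)
  have h4 := key (a := x - y) (b := p - q) (by linarith)
  nlinarith

/-- An extra direction `e` improves the bound `N - 1 / 2` to `N`: in the plane spanned by the common
direction and `e`, the cone lies in a self-dual right-angled cone, whose mean squared distance is `1`. -/
theorem card_le_msd_coneOf (hne : S.Nonempty) (hw : Orthonormal ℝ w) (hρ : 1 ≤ ρ)
    (hc : ∀ a, ∀ s ∈ S, ⟪w a, s⟫ = c a) (hcρ : ∑ a, c a ^ 2 = ρ ^ 2)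
    {e : EuclideanSpace ℝ ι} (he : ‖e‖ = 1) (hwe : ∀ a, ⟪w a, e⟫ = 0)
    (heS : ∀ s ∈ S, |⟪e, s⟫| ≤ 1) : (Fintype.card κ : ℝ) ≤ msd (coneOf S) := by
  have hρ0 : 0 < ρ := by linarith
  set v := commonDirection w c ρ with hv
  have hv1 : ‖v‖ = 1 := norm_commonDirection hρ0 hw hcρ
  have hve : ⟪v, e⟫ = 0 := by
    rw [hv, inner_commonDirection]; simp [hwe]
  have hplus : ‖v + e‖ ^ 2 = 2 := by
    rw [norm_add_sq_real, hve, hv1, he]; norm_num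
  have hminus : ‖v - e‖ ^ 2 = 2 := by
    rw [norm_sub_sq_real, hve, hv1, he]; norm_num
  have hi : Integrable (fun g => (min ⟪v + e, g⟫ 0 ^ 2 + min ⟪v - e, g⟫ 0 ^ 2) / 2)
      (stdGaussian (EuclideanSpace ℝ ι)) :=
    ((integrable_min_inner_sq_stdGaussian _).add
      (integrable_min_inner_sq_stdGaussian _)).div_const 2
  have h := le_msd (coneOf_nonempty hne) ((integrable_sum_inner_sq_sub w v).add hi) ?_
  · simp only [Pi.add_apply] at h
    rw [integral_add (integrable_sum_inner_sq_sub w v) hi, integral_div,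
      integral_add (integrable_min_inner_sq_stdGaussian _)
      (integrable_min_inner_sq_stdGaussian _),
      integral_sum_inner_sq_sub hw hv1, integral_min_inner_sq_stdGaussian,
      integral_min_inner_sq_stdGaussian, hplus, hminus] at h
    linarith
  · rintro g _ ⟨t, ht, s, hs, rfl⟩
    refine le_trans ?_ (sum_inner_sq_add_inner_sq_le hw he hwe _)
    rw [sum_inner_sub_smul_sq hρ0 hc hcρ g t hs, ← hv]
    have h1 : |t * ⟪e, s⟫| ≤ t * ρ := by
      rw [abs_mul, abs_of_nonneg ht]
      exact mul_le_mul_of_nonneg_left ((heS s hs).trans hρ) ht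
    have h2 := min_sq_add_min_sq_le (x := ⟪v, g⟫) (y := ⟪e, g⟫) h1
    simp only [Pi.add_apply, inner_add_left, inner_sub_left]
    rw [inner_sub_right, real_inner_smul_right]
    linarith

/-- The common form of the three estimates. With `N` the size of the orthonormal family, the gap
between the minimum and the cone is at most `2 σ / ρ` and the cone has `msd` at least `N`. The exception
is a family that spans the whole space: the set is then a single point, the cone only has `msd` at
least `N - 1 / 2`, but the minimum is at most `N`. -/
theorem sandwich_of_orthonormal (hne : S.Nonempty) (hcl : IsClosed S) (hconv : Convex ℝ S)
    {σ : ℝ} (hσ : ∀ s ∈ S, ‖s‖ ≤ σ) [Nonempty κ] (hw : Orthonormal ℝ w) (hρ : 1 ≤ ρ)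
    (hc : ∀ a, ∀ s ∈ S, ⟪w a, s⟫ = c a) (hcρ : ∑ a, c a ^ 2 = ρ ^ 2)
    (hcase : Fintype.card κ = Fintype.card ι ∨ ∃ e : EuclideanSpace ℝ ι, ‖e‖ = 1 ∧
      (∀ a, ⟪w a, e⟫ = 0) ∧ ∀ s ∈ S, |⟪e, s⟫| ≤ 1) :
    ∃ m : ℝ, IsLeast {D | ∃ t : ℝ, 0 ≤ t ∧ D = msd (t • S)} m ∧
      1 ≤ m / msd (coneOf S) ∧
      m / msd (coneOf S) ≤ 1 + 2 * (σ / (ρ * Fintype.card κ)) := by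
  have hρ0 : 0 < ρ := by linarith
  have hv1 := norm_commonDirection hρ0 hw hcρ
  have hvS := fun s (hs : s ∈ S) => inner_commonDirection_of_mem hρ0 hc hcρ hs
  obtain ⟨m, hm⟩ := exists_isLeast_msd_smul hne hσ hv1 hρ0 hvS
  have hN : (1 : ℝ) ≤ Fintype.card κ := by exact_mod_cast Fintype.card_pos
  have hhalf := card_sub_half_le_msd_coneOf hne hw hρ0 hc hcρ
  have hpos : 0 < msd (coneOf S) := by linarith
  obtain ⟨s, hs⟩ := id hne
  have hρσ : ρ ≤ σ := by
    have h1 := real_inner_le_norm (commonDirection w c ρ) s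
    rw [hvS s hs, hv1, one_mul] at h1
    exact h1.trans (hσ s hs)
  have hσ0 : 0 < σ := by linarith
  refine ⟨m, hm, ?_, ?_⟩
  · rw [le_div_iff₀ hpos, one_mul]
    obtain ⟨t, ht, h⟩ := hm.1
    rw [h]
    exact msd_coneOf_le_msd_smul hne ht
  · rw [div_le_iff₀ hpos]
    set N : ℝ := (Fintype.card κ : ℝ) with hNdef
    rcases hcase with h | ⟨e, he, hwe, heS⟩
    · have h1 : m ≤ N := by
        refine hm.2 ⟨0, le_rfl, ?_⟩
        rw [msd_zero_smul hne, ← h]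
      have h2 : 1 / N ≤ σ / (ρ * N) := by
        rw [div_le_div_iff₀ (by positivity) (by positivity)]
        nlinarith
      have h3 : N ≤ (1 + 2 * (1 / N)) * (N - 1 / 2) := by
        field_simp
        nlinarith
      calc m ≤ (1 + 2 * (1 / N)) * (N - 1 / 2) := h1.trans h3
        _ ≤ (1 + 2 * (σ / (ρ * N))) * msd (coneOf S) := by
          gcongr
          linarith
    · have hle := card_le_msd_coneOf hne hw hρ hc hcρ he hwe heS
      obtain ⟨t, ht, h⟩ := exists_msd_smul_le_msd_coneOf_add hne hcl hconv hσ hv1 hρ0 hvS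
      have h1 : m ≤ msd (t • S) := hm.2 ⟨t, ht, rfl⟩
      have h2 : σ / ρ ≤ σ / (ρ * N) * msd (coneOf S) := by
        calc σ / ρ = σ / (ρ * N) * N := by field_simp
          _ ≤ _ := mul_le_mul_of_nonneg_left hle (by positivity)
      linarith

end Sandwich

/-! ### Subdifferentials of homogeneous functions -/

section Subdifferential

open scoped RealInnerProductSpace

variable {ι : Type*} [Fintype ι] {f : EuclideanSpace ℝ ι → ℝ} {x s : EuclideanSpace ℝ ι}

theorem convex_subdifferential : Convex ℝ (subdifferential f x) := by
  intro s hs u hu a b ha hb hab y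
  have h1 := mul_le_mul_of_nonneg_left (hs y) ha
  have h2 := mul_le_mul_of_nonneg_left (hu y) hb
  rw [inner_add_left, real_inner_smul_left, real_inner_smul_left]
  have h3 : a = 1 - b := by linarith
  subst h3
  linarith

theorem isClosed_subdifferential : IsClosed (subdifferential f x) := by
  have h : subdifferential f x = ⋂ y, {s | f x + ⟪s, y - x⟫ ≤ f y} := by
    ext s; simp [subdifferential]
  rw [h]
  exact isClosed_iInter fun y => isClosed_le (by fun_prop) continuous_const

/-- Euler's identity together with the dual norm bound characterizes subgradients. -/
theorem mem_subdifferential_iff_of_homogeneous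
    (hf : ∀ c : ℝ, 0 ≤ c → ∀ y, f (c • y) = c * f y) :
    s ∈ subdifferential f x ↔ ⟪s, x⟫ = f x ∧ ∀ y, ⟪s, y⟫ ≤ f y := by
  constructor
  · intro hs
    have h0 := hs ((0 : ℝ) • x)
    have h2 := hs ((2 : ℝ) • x)
    rw [hf _ le_rfl, inner_sub_right, real_inner_smul_right] at h0
    rw [hf _ zero_le_two, inner_sub_right, real_inner_smul_right] at h2
    have hx : ⟪s, x⟫ = f x := by linarith
    refine ⟨hx, fun y => ?_⟩
    have := hs y
    rw [inner_sub_right] at this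
    linarith
  · rintro ⟨h1, h2⟩ y
    rw [inner_sub_right]
    linarith [h2 y]

end Subdifferential

/-! ### The `ℓ₁,₂` norm -/

section Block

open scoped RealInnerProductSpace

variable {n t : ℕ} {blk : Fin n → Fin t} {x s y : EuclideanSpace ℝ (Fin n)}

theorem EuclideanSpace.real_inner_eq_sum {ι : Type*} [Fintype ι] (x y : EuclideanSpace ℝ ι) :
    ⟪x, y⟫ = ∑ i, x i * y i := by
  simp [PiLp.inner_apply, mul_comm]

/-- The Euclidean norm of the `i`-th block of `x`. -/
noncomputable def blockNorm (blk : Fin n → Fin t) (x : EuclideanSpace ℝ (Fin n)) (i : Fin t) : ℝ :=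
  √(∑ j with blk j = i, x j ^ 2)

theorem blockNorm_nonneg (i : Fin t) : 0 ≤ blockNorm blk x i := Real.sqrt_nonneg _

theorem blockNorm_sq (i : Fin t) : blockNorm blk x i ^ 2 = ∑ j with blk j = i, x j ^ 2 :=
  Real.sq_sqrt (Finset.sum_nonneg fun _ _ => sq_nonneg _)

theorem abs_apply_le_blockNorm (j : Fin n) : |x j| ≤ blockNorm blk x (blk j) := by
  refine Real.abs_le_sqrt ?_
  exact Finset.single_le_sum (f := fun j => x j ^ 2) (fun _ _ => sq_nonneg _) (by simp)

theorem blockNorm_pos_iff {i : Fin t} : 0 < blockNorm blk x i ↔ ∃ j, blk j = i ∧ x j ≠ 0 := by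
  rw [blockNorm, Real.sqrt_pos, Finset.sum_pos_iff_of_nonneg fun _ _ => sq_nonneg _]
  simp [sq_pos_iff]

theorem inner_eq_sum_block (blk : Fin n → Fin t) (s y : EuclideanSpace ℝ (Fin n)) :
    ⟪s, y⟫ = ∑ i, ∑ j with blk j = i, s j * y j := by
  rw [EuclideanSpace.real_inner_eq_sum, Finset.sum_fiberwise]

theorem sum_block_mul_le (i : Fin t) :
    ∑ j with blk j = i, s j * y j ≤ blockNorm blk s i * blockNorm blk y i :=
  Real.sum_mul_le_sqrt_mul_sqrt _ _ _

theorem l12Norm_eq_sum_blockNorm : l12Norm blk x = ∑ i, blockNorm blk x i := rfl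

theorem l12Norm_smul {c : ℝ} (hc : 0 ≤ c) : l12Norm blk (c • x) = c * l12Norm blk x := by
  rw [l12Norm, l12Norm, Finset.mul_sum]
  refine Finset.sum_congr rfl fun i _ => ?_
  simp only [PiLp.smul_apply, smul_eq_mul, mul_pow]
  rw [← Finset.mul_sum, Real.sqrt_mul (sq_nonneg _), Real.sqrt_sq hc]

theorem mem_subdifferential_l12Norm_iff : s ∈ subdifferential (l12Norm blk) x ↔
    ⟪s, x⟫ = l12Norm blk x ∧ ∀ y, ⟪s, y⟫ ≤ l12Norm blk y :=
  mem_subdifferential_iff_of_homogeneous fun _ hc _ => l12Norm_smul hc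

theorem blockNorm_le_one_of_mem (hs : s ∈ subdifferential (l12Norm blk) x) (i : Fin t) :
    blockNorm blk s i ≤ 1 := by
  -- test the subgradient against its own restriction to the block `i`
  set y : EuclideanSpace ℝ (Fin n) := WithLp.toLp 2 fun j => if blk j = i then s j else 0 with hy
  have h1 := (mem_subdifferential_l12Norm_iff.1 hs).2 y
  have h2 : ⟪s, y⟫ = blockNorm blk s i ^ 2 := by
    rw [EuclideanSpace.real_inner_eq_sum, blockNorm_sq, Finset.sum_filter]
    refine Finset.sum_congr rfl fun j _ => ?_
    simp only [hy]
    split_ifs <;> ring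
  have h3 : l12Norm blk y = blockNorm blk s i := by
    rw [l12Norm_eq_sum_blockNorm, Finset.sum_eq_single i]
    · rw [blockNorm, blockNorm]
      congr 1
      refine Finset.sum_congr rfl fun j hj => ?_
      simp [hy, (Finset.mem_filter.1 hj).2]
    · intro i' _ hne
      rw [blockNorm, Real.sqrt_eq_zero', Finset.sum_eq_zero]
      intro j hj
      simp [hy, (Finset.mem_filter.1 hj).2, hne]
    · simp
  rw [h2, h3] at h1
  by_contra! h
  nlinarith

/-- A subgradient has equality in the Cauchy–Schwarz inequality on every block, hence is determined on
the blocks where `x` does not vanish. -/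
theorem apply_eq_div_blockNorm_of_mem (hs : s ∈ subdifferential (l12Norm blk) x) {j : Fin n}
    (hj : 0 < blockNorm blk x (blk j)) : s j = x j / blockNorm blk x (blk j) := by
  have h1 := (mem_subdifferential_l12Norm_iff.1 hs).1
  rw [inner_eq_sum_block blk, l12Norm_eq_sum_blockNorm] at h1
  have hle : ∀ i ∈ Finset.univ, ∑ j with blk j = i, s j * x j ≤ blockNorm blk x i := fun i _ =>
    sum_block_mul_le i |>.trans
      (mul_le_of_le_one_left (blockNorm_nonneg i) (blockNorm_le_one_of_mem hs i))
  have heq := (Finset.sum_eq_sum_iff_of_le hle).1 h1 (blk j) (Finset.mem_univ _)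
  set B := blockNorm blk x (blk j) with hB
  have hzero : ∑ l with blk l = blk j, (s l - x l / B) ^ 2 ≤ 0 := by
    have h2 : ∀ l, (s l - x l / B) ^ 2 = s l ^ 2 - 2 / B * (s l * x l) + 1 / B ^ 2 * x l ^ 2 :=
      fun l => by field_simp; ring
    simp_rw [h2]
    rw [Finset.sum_add_distrib, Finset.sum_sub_distrib, ← Finset.mul_sum, ← Finset.mul_sum,
      ← blockNorm_sq, ← blockNorm_sq, heq, ← hB]
    have h3 : blockNorm blk s (blk j) ^ 2 ≤ 1 :=
      pow_le_one₀ (blockNorm_nonneg _) (blockNorm_le_one_of_mem hs _)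
    field_simp
    linarith
  have h4 := (Finset.sum_eq_zero_iff_of_nonneg fun _ _ => sq_nonneg _).1
    (le_antisymm hzero (Finset.sum_nonneg fun _ _ => sq_nonneg _)) j (by simp)
  exact sub_eq_zero.1 (pow_eq_zero_iff two_ne_zero |>.1 h4)

theorem norm_le_sqrt_of_mem_subdifferential_l12Norm
    (hs : s ∈ subdifferential (l12Norm blk) x) : ‖s‖ ≤ √t := by
  refine Real.le_sqrt_of_sq_le ?_
  rw [← real_inner_self_eq_norm_sq, inner_eq_sum_block blk]
  calc ∑ i, ∑ j with blk j = i, s j * s j ≤ ∑ _i : Fin t, (1 : ℝ) := by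
        refine Finset.sum_le_sum fun i _ => ?_
        simp_rw [← sq]
        rw [← blockNorm_sq]
        exact pow_le_one₀ (blockNorm_nonneg _) (blockNorm_le_one_of_mem hs _)
    _ = t := by simp

theorem sum_div_blockNorm_sq {i : Fin t} (hi : 0 < blockNorm blk x i) :
    ∑ j with blk j = i, (x j / blockNorm blk x (blk j)) ^ 2 = 1 := by
  have h : ∀ j ∈ Finset.univ.filter (fun j => blk j = i),
      (x j / blockNorm blk x (blk j)) ^ 2 = x j ^ 2 / blockNorm blk x i ^ 2 := fun j hj => by
    rw [(Finset.mem_filter.1 hj).2, div_pow]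
  rw [Finset.sum_congr rfl h, ← Finset.sum_div, ← blockNorm_sq, div_self (by positivity)]

/-- The normalized blocks of `x` form a subgradient; on zero blocks `x j / 0 = 0`. -/
theorem subdifferential_l12Norm_nonempty : (subdifferential (l12Norm blk) x).Nonempty := by
  set s : EuclideanSpace ℝ (Fin n) := WithLp.toLp 2 fun j => x j / blockNorm blk x (blk j) with hs
  have hle : ∀ i, blockNorm blk s i ≤ 1 := fun i => by
    rcases (blockNorm_nonneg (blk := blk) (x := x) i).eq_or_lt with h | h
    · rw [blockNorm, Finset.sum_eq_zero]
      · simp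
      · intro j hj
        simp [hs, (Finset.mem_filter.1 hj).2, ← h]
    · rw [blockNorm, hs]
      simp only
      rw [sum_div_blockNorm_sq h, Real.sqrt_one]
  refine ⟨s, mem_subdifferential_l12Norm_iff.2 ⟨?_, fun y => ?_⟩⟩
  · rw [inner_eq_sum_block blk, l12Norm_eq_sum_blockNorm]
    refine Finset.sum_congr rfl fun i _ => ?_
    have h : ∀ j ∈ Finset.univ.filter (fun j => blk j = i),
        s j * x j = x j ^ 2 / blockNorm blk x i := fun j hj => by
      simp only [hs, (Finset.mem_filter.1 hj).2]
      ring
    rw [Finset.sum_congr rfl h, ← Finset.sum_div, ← blockNorm_sq, sq, mul_self_div_self]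
  · rw [inner_eq_sum_block blk, l12Norm_eq_sum_blockNorm]
    exact Finset.sum_le_sum fun i _ => (sum_block_mul_le i).trans
      (mul_le_of_le_one_left (blockNorm_nonneg i) (hle i))

theorem sandwich_l12Norm {b k : ℕ} (hb : ∀ i, {j | blk j = i}.ncard = b) (hk : 1 ≤ k)
    (hx : {i | ∃ j, blk j = i ∧ x j ≠ 0}.ncard = k) :
    ∃ m : ℝ, IsLeast {D | ∃ c : ℝ, 0 ≤ c ∧ D = msd (c • subdifferential (l12Norm blk) x)} m ∧
      1 ≤ m / msd (coneOf (subdifferential (l12Norm blk) x)) ∧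
      m / msd (coneOf (subdifferential (l12Norm blk) x)) ≤
        1 + 2 * √((t : ℝ) / ((b : ℝ) ^ 2 * (k : ℝ) ^ 3)) := by
  classical
  have hA : (Finset.univ.filter fun i => 0 < blockNorm blk x i).card = k := by
    rw [← hx, ← Set.ncard_coe_finset]
    congr 1
    ext i
    simp [blockNorm_pos_iff]
  have hbc : ∀ i, (Finset.univ.filter fun j => blk j = i).card = b := fun i => by
    rw [← hb i, ← Set.ncard_coe_finset]
    congr 1
    ext j
    simp
  -- the orthonormal family consists of the coordinate vectors of the `k` nonzero blocks
  have hcard : Fintype.card {j // 0 < blockNorm blk x (blk j)} = k * b := by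
    rw [Fintype.card_subtype, Finset.card_eq_sum_card_fiberwise (f := blk)
      (t := Finset.univ.filter fun i => 0 < blockNorm blk x i) (by intro j; simp)]
    rw [Finset.sum_congr rfl (g := fun _ => b), Finset.sum_const, hA, smul_eq_mul]
    intro i hi
    rw [← hbc i, Finset.filter_filter]
    congr 1
    ext j
    have := (Finset.mem_filter.1 hi).2
    simp only [Finset.mem_filter, Finset.mem_univ, true_and]
    exact ⟨fun h => h.2, fun h => ⟨h ▸ this, h⟩⟩
  have hone : (1 : ℝ) ≤ k := by exact_mod_cast hk
  have hne : Nonempty {j // 0 < blockNorm blk x (blk j)} := by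
    obtain ⟨i, hi⟩ := Finset.card_pos.1 (by rw [hA]; exact hk)
    have hi' := (Finset.mem_filter.1 hi).2
    obtain ⟨j, rfl, -⟩ := blockNorm_pos_iff.1 hi'
    exact ⟨⟨j, hi'⟩⟩
  have hbasis := (EuclideanSpace.basisFun (Fin n) ℝ).orthonormal
  have hsum : ∑ j : {j // 0 < blockNorm blk x (blk j)},
      (x j / blockNorm blk x (blk j)) ^ 2 = √(k : ℝ) ^ 2 := by
    rw [Real.sq_sqrt (by positivity), ← Finset.sum_subtype
      (Finset.univ.filter fun j => 0 < blockNorm blk x (blk j)) (by simp)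
      fun j => (x j / blockNorm blk x (blk j)) ^ 2, ← Finset.sum_fiberwise_of_maps_to (g := blk)
      (t := Finset.univ.filter fun i => 0 < blockNorm blk x i) (by intro j; simp),
      Finset.sum_congr rfl (g := fun _ => (1 : ℝ))]
    · simp [hA]
    · intro i hi
      have hi' := (Finset.mem_filter.1 hi).2
      rw [← sum_div_blockNorm_sq hi', Finset.filter_filter]
      refine Finset.sum_congr (Finset.filter_congr fun j _ => ?_) fun _ _ => rfl
      exact ⟨fun h => h.2, fun h => ⟨h ▸ hi', h⟩⟩
  have := sandwich_of_orthonormal (subdifferential_l12Norm_nonempty (blk := blk) (x := x))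
    isClosed_subdifferential convex_subdifferential
    (fun s hs => norm_le_sqrt_of_mem_subdifferential_l12Norm hs)
    (w := fun j : {j // 0 < blockNorm blk x (blk j)} => EuclideanSpace.basisFun (Fin n) ℝ j)
    (c := fun j => x j / blockNorm blk x (blk j)) (ρ := √k)
    (hbasis.comp _ Subtype.val_injective) (Real.one_le_sqrt.2 hone)
    (fun j s hs => by
      rw [EuclideanSpace.basisFun_inner]; exact apply_eq_div_blockNorm_of_mem hs j.2) hsum ?_
  · have hbpos : 0 < b := by
      have := Fintype.card_pos (α := {j // 0 < blockNorm blk x (blk j)})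
      rw [hcard] at this
      exact pos_of_mul_pos_right this (by omega)
    convert this using 5
    have hb0 : (0 : ℝ) < b := by exact_mod_cast hbpos
    have hk0 : (0 : ℝ) < k := by linarith
    have h1 : ((k * b : ℕ) : ℝ) = √(((k : ℝ) * b) ^ 2) := by
      rw [Real.sqrt_sq (by positivity), Nat.cast_mul]
    rw [hcard, h1, ← Real.sqrt_mul hk0.le, ← Real.sqrt_div (Nat.cast_nonneg t)]
    congr 1
    field_simp
  · by_cases hall : ∀ j, 0 < blockNorm blk x (blk j)
    · left
      exact Fintype.card_congr (Equiv.subtypeUnivEquiv hall)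
    · right
      push Not at hall
      obtain ⟨j, hj⟩ := hall
      refine ⟨EuclideanSpace.basisFun (Fin n) ℝ j, hbasis.1 j, fun a => ?_, fun s hs => ?_⟩
      · refine hbasis.2 fun h => ?_
        have := a.2
        rw [h] at this
        linarith
      · rw [EuclideanSpace.basisFun_inner]
        exact (abs_apply_le_blockNorm j).trans (blockNorm_le_one_of_mem hs _)

theorem l1Norm_eq_l12Norm_id (n : ℕ) : (l1Norm (n := n)) = l12Norm (t := n) id := by
  ext x
  simp [l1Norm, l12Norm, Finset.filter_eq', Real.sqrt_sq_eq_abs]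

end Block

/-! ### The nuclear norm -/

section Nuclear

open scoped RealInnerProductSpace

variable {d : ℕ} {x s y : EuclideanSpace ℝ (Fin d × Fin d)}

/-- The linear map on `ℝᵈ` whose matrix is `unvec y`. -/
noncomputable def unvecLin (y : EuclideanSpace ℝ (Fin d × Fin d)) :
    EuclideanSpace ℝ (Fin d) →ₗ[ℝ] EuclideanSpace ℝ (Fin d) :=
  Matrix.toEuclideanLin (unvec y)

/-- The vectorization of the rank-one matrix `a vᵀ`. -/
noncomputable def outerVec (a v : EuclideanSpace ℝ (Fin d)) : EuclideanSpace ℝ (Fin d × Fin d) :=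
  WithLp.toLp 2 fun p => a p.1 * v p.2

theorem unvecLin_apply (z : EuclideanSpace ℝ (Fin d)) (i : Fin d) :
    unvecLin y z i = ∑ j, y (i, j) * z j := by
  simp [unvecLin, Matrix.toLpLin_apply, Matrix.mulVec, dotProduct, unvec]

theorem unvecLin_outerVec (a v z : EuclideanSpace ℝ (Fin d)) :
    unvecLin (outerVec a v) z = ⟪v, z⟫ • a := by
  ext i
  rw [unvecLin_apply, PiLp.smul_apply, EuclideanSpace.real_inner_eq_sum, smul_eq_mul,
    Finset.sum_mul]
  exact Finset.sum_congr rfl fun j _ => by simp only [outerVec]; ring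

theorem unvecLin_sum {κ : Type*} (A : Finset κ) (f : κ → EuclideanSpace ℝ (Fin d × Fin d))
    (z : EuclideanSpace ℝ (Fin d)) :
    unvecLin (∑ i ∈ A, f i) z = ∑ i ∈ A, unvecLin (f i) z := by
  ext i
  simp only [unvecLin_apply, WithLp.ofLp_sum, Finset.sum_apply, Finset.sum_mul]
  exact Finset.sum_comm

theorem inner_outerVec (a v : EuclideanSpace ℝ (Fin d)) :
    ⟪outerVec a v, s⟫ = ⟪a, unvecLin s v⟫ := by
  rw [EuclideanSpace.real_inner_eq_sum, EuclideanSpace.real_inner_eq_sum,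
    Fintype.sum_prod_type]
  simp_rw [unvecLin_apply, Finset.mul_sum]
  exact Finset.sum_congr rfl fun i _ => Finset.sum_congr rfl fun j _ => by
    simp only [outerVec]; ring

theorem inner_outerVec_outerVec (a v b w : EuclideanSpace ℝ (Fin d)) :
    ⟪outerVec a v, outerVec b w⟫ = ⟪a, b⟫ * ⟪v, w⟫ := by
  rw [inner_outerVec, unvecLin_outerVec, real_inner_smul_right, real_inner_comm, mul_comm]

theorem inner_eq_sum_inner_unvecLin (b : OrthonormalBasis (Fin d) ℝ (EuclideanSpace ℝ (Fin d)))
    (s y : EuclideanSpace ℝ (Fin d × Fin d)) :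
    ⟪s, y⟫ = ∑ i, ⟪unvecLin s (b i), unvecLin y (b i)⟫ := by
  -- both sides are the trace of `(unvecLin s)ᵀ ∘ unvecLin y`
  have h : ∀ b : OrthonormalBasis (Fin d) ℝ (EuclideanSpace ℝ (Fin d)),
      ∑ i, ⟪unvecLin s (b i), unvecLin y (b i)⟫ =
        LinearMap.trace ℝ _ ((unvecLin s).adjoint ∘ₗ unvecLin y) := fun b => by
    rw [LinearMap.trace_eq_sum_inner _ b]
    simp [LinearMap.adjoint_inner_right]
  rw [h b, ← h (EuclideanSpace.basisFun (Fin d) ℝ), EuclideanSpace.real_inner_eq_sum,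
    Fintype.sum_prod_type, Finset.sum_comm]
  refine Finset.sum_congr rfl fun j _ => ?_
  rw [EuclideanSpace.real_inner_eq_sum]
  simp [unvecLin_apply]

/-- A right singular basis of `unvec y`: an orthonormal eigenbasis of `(unvec y)ᵀ (unvec y)`. -/
noncomputable def rightSingularBasis (y : EuclideanSpace ℝ (Fin d × Fin d)) :
    OrthonormalBasis (Fin d) ℝ (EuclideanSpace ℝ (Fin d)) :=
  (unvecLin y).isSymmetric_adjoint_comp_self.eigenvectorBasis finrank_euclideanSpace_fin

theorem inner_unvecLin_rightSingularBasis (i j : Fin d) :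
    ⟪unvecLin y (rightSingularBasis y i), unvecLin y (rightSingularBasis y j)⟫ =
      (unvecLin y).singularValues i ^ 2 *
        ⟪rightSingularBasis y i, rightSingularBasis y j⟫ := by
  rw [(unvecLin y).sq_singularValues_fin finrank_euclideanSpace_fin,
    ← LinearMap.adjoint_inner_left, ← LinearMap.comp_apply, rightSingularBasis,
    LinearMap.IsSymmetric.apply_eigenvectorBasis, real_inner_smul_left]
  rfl

theorem norm_unvecLin_rightSingularBasis (i : Fin d) :
    ‖unvecLin y (rightSingularBasis y i)‖ = (unvecLin y).singularValues i := by
  have h := inner_unvecLin_rightSingularBasis (y := y) i i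
  rw [real_inner_self_eq_norm_sq, real_inner_self_eq_norm_sq, (rightSingularBasis y).norm_eq_one,
    one_pow, mul_one] at h
  exact (sq_eq_sq₀ (norm_nonneg _) ((unvecLin y).singularValues_nonneg i)).1 h

theorem nuclearNorm_eq_sum_norm :
    nuclearNorm y = ∑ i, ‖unvecLin y (rightSingularBasis y i)‖ := by
  rw [nuclearNorm, Finset.sum_range]
  exact Finset.sum_congr rfl fun i _ => (norm_unvecLin_rightSingularBasis i).symm

/-- The left singular vectors of `unvec y`; the vector is `0` where the singular value is `0`. -/
noncomputable def leftSingularVec (y : EuclideanSpace ℝ (Fin d × Fin d)) (i : Fin d) :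
    EuclideanSpace ℝ (Fin d) :=
  ‖unvecLin y (rightSingularBasis y i)‖⁻¹ • unvecLin y (rightSingularBasis y i)

theorem norm_leftSingularVec_le (i : Fin d) : ‖leftSingularVec y i‖ ≤ 1 := by
  rw [leftSingularVec, norm_smul, norm_inv, norm_norm]
  exact inv_mul_le_one

theorem norm_leftSingularVec {i : Fin d} (hi : 0 < (unvecLin y).singularValues i) :
    ‖leftSingularVec y i‖ = 1 := by
  rw [leftSingularVec, norm_smul, norm_inv, norm_norm, norm_unvecLin_rightSingularBasis,
    inv_mul_cancel₀ hi.ne']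

theorem inner_leftSingularVec_unvecLin (i : Fin d) :
    ⟪leftSingularVec y i, unvecLin y (rightSingularBasis y i)⟫ =
      ‖unvecLin y (rightSingularBasis y i)‖ := by
  rw [leftSingularVec, real_inner_smul_left, real_inner_self_eq_norm_sq, sq, ← mul_assoc]
  rcases eq_or_ne ‖unvecLin y (rightSingularBasis y i)‖ 0 with h | h
  · rw [h, mul_zero]
  · rw [inv_mul_cancel₀ h, one_mul]

theorem inner_leftSingularVec_of_ne {i j : Fin d} (hij : i ≠ j) :
    ⟪leftSingularVec y i, leftSingularVec y j⟫ = 0 := by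
  rw [leftSingularVec, leftSingularVec, real_inner_smul_left, real_inner_smul_right,
    inner_unvecLin_rightSingularBasis, (rightSingularBasis y).orthonormal.2 hij]
  simp

/-- Contractions are in the dual unit ball of the nuclear norm. -/
theorem inner_le_nuclearNorm (hs : ∀ z, ‖unvecLin s z‖ ≤ ‖z‖)
    (y : EuclideanSpace ℝ (Fin d × Fin d)) : ⟪s, y⟫ ≤ nuclearNorm y := by
  rw [inner_eq_sum_inner_unvecLin (rightSingularBasis y), nuclearNorm_eq_sum_norm]
  refine Finset.sum_le_sum fun i _ => (real_inner_le_norm _ _).trans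
    (mul_le_of_le_one_left (norm_nonneg _) ?_)
  simpa using hs (rightSingularBasis y i)

/-- The vectorization of the polar factor `∑ uᵢ vᵢᵀ` of `unvec y`. -/
noncomputable def polarVec (y : EuclideanSpace ℝ (Fin d × Fin d)) :
    EuclideanSpace ℝ (Fin d × Fin d) :=
  ∑ i, outerVec (leftSingularVec y i) (rightSingularBasis y i)

theorem norm_unvecLin_polarVec_le (z : EuclideanSpace ℝ (Fin d)) :
    ‖unvecLin (polarVec y) z‖ ≤ ‖z‖ := by
  refine le_of_sq_le_sq ?_ (norm_nonneg _)
  rw [polarVec, unvecLin_sum, ← (rightSingularBasis y).sum_sq_inner_right z,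
    ← real_inner_self_eq_norm_sq, sum_inner]
  simp_rw [unvecLin_outerVec, real_inner_smul_left, inner_sum, real_inner_smul_right]
  refine Finset.sum_le_sum fun i _ => ?_
  rw [Finset.sum_eq_single i (fun j _ hj => by rw [inner_leftSingularVec_of_ne hj.symm, mul_zero])
    (by simp), real_inner_self_eq_norm_sq]
  have := pow_le_one₀ (n := 2) (norm_nonneg _) (norm_leftSingularVec_le (y := y) i)
  nlinarith [sq_nonneg ⟪rightSingularBasis y i, z⟫]

theorem inner_polarVec : ⟪polarVec y, y⟫ = nuclearNorm y := by
  rw [polarVec, sum_inner, nuclearNorm_eq_sum_norm]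
  exact Finset.sum_congr rfl fun i _ => by
    rw [inner_outerVec, inner_leftSingularVec_unvecLin]

theorem nuclearNorm_smul {c : ℝ} (hc : 0 ≤ c) (y : EuclideanSpace ℝ (Fin d × Fin d)) :
    nuclearNorm (c • y) = c * nuclearNorm y := by
  refine le_antisymm ?_ ?_
  · rw [← inner_polarVec, real_inner_smul_right]
    exact mul_le_mul_of_nonneg_left (inner_le_nuclearNorm norm_unvecLin_polarVec_le y) hc
  · rw [← inner_polarVec, ← real_inner_smul_right]
    exact inner_le_nuclearNorm norm_unvecLin_polarVec_le _

theorem nuclearNorm_outerVec_le (a v : EuclideanSpace ℝ (Fin d)) :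
    nuclearNorm (outerVec a v) ≤ ‖a‖ * ‖v‖ := by
  rw [← inner_polarVec, real_inner_comm, inner_outerVec]
  exact (real_inner_le_norm _ _).trans
    (mul_le_mul_of_nonneg_left (norm_unvecLin_polarVec_le v) (norm_nonneg a))

theorem mem_subdifferential_nuclearNorm_iff : s ∈ subdifferential nuclearNorm x ↔
    ⟪s, x⟫ = nuclearNorm x ∧ ∀ y, ⟪s, y⟫ ≤ nuclearNorm y :=
  mem_subdifferential_iff_of_homogeneous fun _ hc _ => nuclearNorm_smul hc _

theorem subdifferential_nuclearNorm_nonempty : (subdifferential nuclearNorm x).Nonempty :=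
  ⟨polarVec x, mem_subdifferential_nuclearNorm_iff.2
    ⟨inner_polarVec, inner_le_nuclearNorm norm_unvecLin_polarVec_le⟩⟩

/-- Testing a subgradient on rank-one matrices shows that it is a contraction. -/
theorem norm_unvecLin_le_of_mem (hs : s ∈ subdifferential nuclearNorm x)
    (z : EuclideanSpace ℝ (Fin d)) : ‖unvecLin s z‖ ≤ ‖z‖ := by
  have h := ((mem_subdifferential_nuclearNorm_iff.1 hs).2 _).trans
    (nuclearNorm_outerVec_le (unvecLin s z) z)
  rw [real_inner_comm, inner_outerVec, real_inner_self_eq_norm_sq] at h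
  by_contra! hlt
  nlinarith [norm_nonneg z]

theorem norm_le_sqrt_of_mem_subdifferential_nuclearNorm
    (hs : s ∈ subdifferential nuclearNorm x) : ‖s‖ ≤ √d := by
  refine Real.le_sqrt_of_sq_le ?_
  rw [← real_inner_self_eq_norm_sq, inner_eq_sum_inner_unvecLin (rightSingularBasis x)]
  calc ∑ i, ⟪unvecLin s (rightSingularBasis x i), unvecLin s (rightSingularBasis x i)⟫
      ≤ ∑ _i : Fin d, (1 : ℝ) := by
        refine Finset.sum_le_sum fun i _ => ?_
        rw [real_inner_self_eq_norm_sq]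
        refine pow_le_one₀ (norm_nonneg _) ?_
        simpa using norm_unvecLin_le_of_mem hs (rightSingularBasis x i)
    _ = d := by simp

/-- A subgradient maps each right singular vector with positive singular value to the corresponding
left singular vector, by equality in the duality `⟪s, x⟫ ≤ nuclearNorm x`. -/
theorem unvecLin_rightSingularBasis_of_mem (hs : s ∈ subdifferential nuclearNorm x) {i : Fin d}
    (hi : 0 < (unvecLin x).singularValues i) :
    unvecLin s (rightSingularBasis x i) = leftSingularVec x i := by
  have h1 := (mem_subdifferential_nuclearNorm_iff.1 hs).1
  rw [inner_eq_sum_inner_unvecLin (rightSingularBasis x), nuclearNorm_eq_sum_norm] at h1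
  have hone : ∀ i, ‖unvecLin s (rightSingularBasis x i)‖ ≤ 1 := fun i => by
    simpa using norm_unvecLin_le_of_mem hs (rightSingularBasis x i)
  have heq := (Finset.sum_eq_sum_iff_of_le fun i _ => (real_inner_le_norm _ _).trans
    (mul_le_of_le_one_left (norm_nonneg _) (hone i))).1 h1 i (Finset.mem_univ i)
  have h2 : ⟪unvecLin s (rightSingularBasis x i), leftSingularVec x i⟫ = 1 := by
    rw [leftSingularVec, real_inner_smul_right, heq, norm_unvecLin_rightSingularBasis,
      inv_mul_cancel₀ hi.ne']
  have h3 : ‖unvecLin s (rightSingularBasis x i) - leftSingularVec x i‖ ^ 2 ≤ 0 := by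
    rw [norm_sub_sq_real, h2, norm_leftSingularVec hi]
    have := pow_le_one₀ (n := 2) (norm_nonneg _) (hone i)
    linarith
  exact sub_eq_zero.1 (norm_eq_zero.1 (pow_eq_zero_iff two_ne_zero |>.1
    (le_antisymm h3 (sq_nonneg _))))

theorem card_singularValues_pos :
    Fintype.card {i : Fin d // 0 < (unvecLin x).singularValues i} = (unvec x).rank := by
  have hr : Module.finrank ℝ (LinearMap.range (unvecLin x)) = (unvec x).rank := by
    rw [unvecLin, Matrix.rank_eq_finrank_range_toLin _ (EuclideanSpace.basisFun (Fin d) ℝ).toBasis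
      (EuclideanSpace.basisFun (Fin d) ℝ).toBasis, Matrix.toEuclideanLin_eq_toLin_orthonormal]
  have hle : (unvec x).rank ≤ d := by simpa using (unvec x).rank_le_card_width
  rw [Fintype.card_subtype, Finset.filter_congr (q := fun i : Fin d => i < (unvec x).rank)
    fun i _ => by rw [LinearMap.singularValues_pos_iff_lt_finrank_range, hr],
    Fin.card_filter_val_lt, min_eq_right hle]

/-- The `d r` rank-one matrices `e_a v_iᵀ`, for `v_i` the right singular vectors with positive singular
value, on which all subgradients agree. -/
theorem orthonormal_outerVec_rightSingularBasis :
    Orthonormal ℝ fun p : Fin d × {i : Fin d // 0 < (unvecLin x).singularValues i} =>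
      outerVec (EuclideanSpace.basisFun (Fin d) ℝ p.1) (rightSingularBasis x p.2) := by
  classical
  rw [orthonormal_iff_ite]
  rintro ⟨a, i⟩ ⟨b, j⟩
  rw [inner_outerVec_outerVec,
    orthonormal_iff_ite.1 (EuclideanSpace.basisFun (Fin d) ℝ).orthonormal,
    orthonormal_iff_ite.1 (rightSingularBasis x).orthonormal]
  simp only [Prod.mk.injEq, Subtype.ext_iff, ← ite_and, ite_mul, one_mul, zero_mul]

theorem sandwich_nuclearNorm {r : ℕ} (hr : 1 ≤ r) (hx : (unvec x).rank = r) :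
    ∃ m : ℝ, IsLeast {D | ∃ c : ℝ, 0 ≤ c ∧ D = msd (c • subdifferential nuclearNorm x)} m ∧
      1 ≤ m / msd (coneOf (subdifferential nuclearNorm x)) ∧
      m / msd (coneOf (subdifferential nuclearNorm x)) ≤
        1 + 2 * √(1 / ((r : ℝ) ^ 3 * (d : ℝ))) := by
  classical
  have hle : (unvec x).rank ≤ d := by simpa using (unvec x).rank_le_card_width
  have hd : 0 < d := by omega
  have : Nonempty (Fin d) := ⟨⟨0, hd⟩⟩
  have hr0 : (1 : ℝ) ≤ r := by exact_mod_cast hr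
  have hcard : Fintype.card {i : Fin d // 0 < (unvecLin x).singularValues i} = r :=
    card_singularValues_pos.trans hx
  have : Nonempty {i : Fin d // 0 < (unvecLin x).singularValues i} :=
    Fintype.card_pos_iff.1 (by omega)
  have hw := orthonormal_outerVec_rightSingularBasis (x := x)
  have hsum : ∑ p : Fin d × {i : Fin d // 0 < (unvecLin x).singularValues i},
      (leftSingularVec x p.2 p.1) ^ 2 = √(r : ℝ) ^ 2 := by
    rw [Real.sq_sqrt (by positivity), Fintype.sum_prod_type_right, ← hcard]
    simp_rw [← EuclideanSpace.real_norm_sq_eq]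
    rw [Finset.sum_congr rfl (g := fun _ => (1 : ℝ)) fun i _ => by
      rw [norm_leftSingularVec i.2, one_pow]]
    simp
  have hc : ∀ p : Fin d × {i : Fin d // 0 < (unvecLin x).singularValues i},
      ∀ s ∈ subdifferential nuclearNorm x,
      ⟪outerVec (EuclideanSpace.basisFun (Fin d) ℝ p.1) (rightSingularBasis x p.2), s⟫ =
        leftSingularVec x p.2 p.1 := fun p s hs => by
    rw [inner_outerVec, unvecLin_rightSingularBasis_of_mem hs p.2.2,
      EuclideanSpace.basisFun_inner]
  have hσ : ∀ s ∈ subdifferential nuclearNorm x, ‖s‖ ≤ √d := fun s hs =>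
    norm_le_sqrt_of_mem_subdifferential_nuclearNorm hs
  have key := sandwich_of_orthonormal (subdifferential_nuclearNorm_nonempty (x := x))
    isClosed_subdifferential convex_subdifferential hσ hw (Real.one_le_sqrt.2 hr0) hc hsum ?_
  · convert key using 5
    have hd0 : (0 : ℝ) < d := by exact_mod_cast hd
    have hr1 : (0 : ℝ) < r := by linarith
    have h1 : ((d * r : ℕ) : ℝ) = √(((d : ℝ) * r) ^ 2) := by
      rw [Real.sqrt_sq (by positivity), Nat.cast_mul]
    rw [Fintype.card_prod, hcard, Fintype.card_fin, h1, ← Real.sqrt_mul hr1.le,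
      ← Real.sqrt_div (Nat.cast_nonneg d)]
    congr 1
    field_simp
  · by_cases hall : ∀ i : Fin d, 0 < (unvecLin x).singularValues i
    · left
      exact Fintype.card_congr ((Equiv.refl _).prodCongr (Equiv.subtypeUnivEquiv hall))
    · right
      push Not at hall
      obtain ⟨j, hj⟩ := hall
      refine ⟨outerVec (rightSingularBasis x j) (rightSingularBasis x j), ?_, fun p => ?_, fun s hs => ?_⟩
      · rw [← sq_eq_sq₀ (norm_nonneg _) zero_le_one, ← real_inner_self_eq_norm_sq,
          inner_outerVec_outerVec, real_inner_self_eq_norm_sq, (rightSingularBasis x).norm_eq_one]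
        norm_num
      · rw [inner_outerVec_outerVec, (rightSingularBasis x).orthonormal.2, mul_zero]
        intro h
        have := p.2.2
        rw [h] at this
        linarith
      · rw [inner_outerVec]
        refine (abs_real_inner_le_norm _ _).trans ?_
        rw [(rightSingularBasis x).norm_eq_one, one_mul]
        simpa using norm_unvecLin_le_of_mem hs (rightSingularBasis x j)

end Nuclear

/-! ### The three norms -/

theorem mainTheorem6 :
    (∀ (n k : ℕ) (x₀ : EuclideanSpace ℝ (Fin n)),
      1 ≤ k → {i | x₀ i ≠ 0}.ncard = k →
      ∃ m : ℝ, IsLeast {D | ∃ c : ℝ, 0 ≤ c ∧ D = msd (c • subdifferential l1Norm x₀)} m ∧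
        1 ≤ m / msd (coneOf (subdifferential l1Norm x₀)) ∧
        m / msd (coneOf (subdifferential l1Norm x₀)) ≤ 1 + 2 * √((n : ℝ) / (k : ℝ) ^ 3)) ∧
    (∀ (d r : ℕ) (x₀ : EuclideanSpace ℝ (Fin d × Fin d)),
      1 ≤ r → (unvec x₀).rank = r →
      ∃ m : ℝ, IsLeast {D | ∃ c : ℝ, 0 ≤ c ∧ D = msd (c • subdifferential nuclearNorm x₀)} m ∧
        1 ≤ m / msd (coneOf (subdifferential nuclearNorm x₀)) ∧
        m / msd (coneOf (subdifferential nuclearNorm x₀)) ≤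
          1 + 2 * √(1 / ((r : ℝ) ^ 3 * (d : ℝ)))) ∧
    (∀ (n t b k : ℕ) (blk : Fin n → Fin t) (x₀ : EuclideanSpace ℝ (Fin n)),
      n = t * b → (∀ i, {j | blk j = i}.ncard = b) →
      1 ≤ k → {i | ∃ j, blk j = i ∧ x₀ j ≠ 0}.ncard = k →
      ∃ m : ℝ, IsLeast {D | ∃ c : ℝ, 0 ≤ c ∧ D = msd (c • subdifferential (l12Norm blk) x₀)} m ∧
        1 ≤ m / msd (coneOf (subdifferential (l12Norm blk) x₀)) ∧
        m / msd (coneOf (subdifferential (l12Norm blk) x₀)) ≤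
          1 + 2 * √((t : ℝ) / ((b : ℝ) ^ 2 * (k : ℝ) ^ 3))) := by
  refine ⟨fun n k x₀ hk hx => ?_, fun d r x₀ hr hx => sandwich_nuclearNorm hr hx,
    fun n t b k blk x₀ _ hb hk hx => sandwich_l12Norm hb hk hx⟩
  have h := sandwich_l12Norm (blk := (id : Fin n → Fin n)) (x := x₀) (b := 1) (k := k)
    (fun i => by simp) hk (by simpa using hx)
  rw [l1Norm_eq_l12Norm_id]
  simpa using h
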